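/- Let $n\ge 1$. For each $i\in[n]$ let $\mathcal M_i=(S_i,A_i,P_i,s_0^i)$ be an MDP with finite state space and finite nonempty action sets $A_i(s)$, let $\pi_i^{\mathcal S}$ be a stationary (reference) policy, and let $R_i\subseteq S_i$ be a set of absorbing states (a state $s$ is absorbing if $\mathrm{Succ}_i(s)=\{s\}$, where $\mathrm{Succ}_i(s)$ is the set of $q$ with $P_i(s,a,q)>0$ for some $a\in A_i(s)$). Let $\nu_{\mathcal A}\ge 0$. For a stationary policy $\pi$ on $\mathcal M_i$ let $\Gamma^{\pi}$ be the law of the infinite state path started at $s_0^i$, and let $\pi_{s,q}=\sum_{a\in A_i(s)}P_i(s,a,q)\pi(s,a)$. Optimal values lie in $[0,\infty]$, and an infeasible problem has value $\infty$. Problem 1: minimise $\max_{i\in[n]}\mathrm{KL}(\Gamma^{\pi_i}\|\Gamma^{\pi_i^{\mathcal S}})$ over tuples $(\pi_i)_{i=1}^n$ of stationary policies on the $\mathcal M_i$ such that, when the agents run independently, the probability that at least one agent $i$ reaches $R_i$ is at least $\nu_{\mathcal A}$. Problem 2 (occupancy formulation): let $C_i$ be the union of the closed communicating classes of the Markov chain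 induced by $(\mathcal M_i,\pi_i^{\mathcal S})$ and $D_i=S_i\setminus(C_i\cup R_i)$. For $\mathbf x_i=(x_{s,a})_{s\in D_i,\,a\in A_i(s)}$ put $x_s=\sum_{a\in A_i(s)}x_{s,a}$ and $x_{s,q}=\sum_{a\in A_i(s)}x_{s,a}P_i(s,a,q)$. Minimise $$\max_{i\in[n]}\ \sum_{s\in D_i}\sum_{q\in \mathrm{Succ}_i(s)}x_{s,q}\log\frac{x_{s,q}}{\pi^{\mathcal S}_{s,q}\,x_s}$$ (where $\pi^{\mathcal S}_{s,q}=(\pi_i^{\mathcal S})_{s,q}$, a term with $x_{s,q}=0$ is $0$, and a term with $x_{s,q}>0=\pi^{\mathcal S}_{s,q}$ is $\infty$) over all tuples $(\mathbf x_i)_{i=1}^n$ subject to $\mathbf x_i\ge 0$ and $x_s-\sum_{q\in D_i}x_{q,s}-\mathbb 1[s=s_0^i]=0$ for all $i\in[n]$ and $s\in D_i$, and $\prod_{i=1}^n\bigl(1-\nu(\mathbf x_i,R_i)\bigr)\le 1-\nu_{\mathcal A}$, where $\nu(\mathbf x_i,R_i)=\sum_{q\in R_i}\bigl(\sum_{s\in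 D_i}x_{s,q}+\mathbb 1[q=s_0^i]\bigr)$. Then Problems 1 and 2 have the same optimal value. If this value is finite, there are stationary policies $(\pi_i)_{i=1}^n$ that are feasible for Problem 1 and attain it; moreover they can be chosen so that their occupancy measures $x_{s,a}=\sum_{t\ge0}\Pr(s_t=s\mid s_0^i)\,\pi_i(s,a)$, $s\in D_i$, $a\in A_i(s)$, are finite and form a feasible point of Problem 2 attaining the same value. -/

import Mathlib

open MeasureTheory ProbabilityTheory
open scoped ENNReal

noncomputable section

/-- A Markov decision process with finite state space `S`, actions in `A`, a finite nonempty set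
`act s` of actions available at each state `s`, transition probabilities `P s a q` and initial
state `s₀`. The values `P s a q` with `a ∉ act s` carry no meaning and are never used. -/
structure MDP (S A : Type*) [Fintype S] where
  act : S → Finset A
  act_nonempty : ∀ s, (act s).Nonempty
  P : S → A → S → ℝ
  P_nonneg : ∀ s, ∀ a ∈ act s, ∀ q, 0 ≤ P s a q
  P_sum : ∀ s, ∀ a ∈ act s, ∑ q, P s a q = 1
  s₀ : S

/-- A stationary policy: a map `S × A → [0, 1]` whose values over the available actions sum to 1
at every state. -/
structure StationaryPolicy {S A : Type*} [Fintype S] (M : MDP S A) where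
  prob : S → A → ℝ
  prob_nonneg : ∀ s a, 0 ≤ prob s a
  prob_le_one : ∀ s a, prob s a ≤ 1
  prob_sum : ∀ s, ∑ a ∈ M.act s, prob s a = 1

namespace MDP

variable {S A : Type*} [Fintype S] (M : MDP S A)

/-- The set of successor states of `s`. -/
def succ (s : S) : Set S := {q | ∃ a ∈ M.act s, 0 < M.P s a q}

/-- An absorbing state is its own only successor. -/
def IsAbsorbing (s : S) : Prop := M.succ s = {s}

end MDP

namespace StationaryPolicy

variable {S A : Type*} [Fintype S] {M : MDP S A} (π : StationaryPolicy M)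

/-- The probability `π_{s,q}` of moving from `s` to `q` under `π`. -/
def trans (s q : S) : ℝ := ∑ a ∈ M.act s, M.P s a q * π.prob s a

lemma trans_nonneg (s q : S) : 0 ≤ π.trans s q :=
  Finset.sum_nonneg fun a ha => mul_nonneg (M.P_nonneg s a ha q) (π.prob_nonneg s a)

lemma trans_sum (s : S) : ∑ q, π.trans s q = 1 := by
  unfold trans
  rw [Finset.sum_comm, ← π.prob_sum s]
  refine Finset.sum_congr rfl fun a ha => ?_
  rw [← Finset.sum_mul, M.P_sum s a ha, one_mul]

/-- The law of the next state, from state `s`. -/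
def next (s : S) : PMF S :=
  PMF.ofFintype (fun q => ENNReal.ofReal (π.trans s q)) (by
    rw [← ENNReal.ofReal_sum_of_nonneg fun q _ => π.trans_nonneg s q, π.trans_sum s,
      ENNReal.ofReal_one])

section Paths

variable [MeasurableSpace S] [MeasurableSingletonClass S]

/-- The Markov kernel of the chain on `S` induced by `π`. -/
def stepKernel : Kernel S S := Kernel.ofFunOfCountable fun s => (π.next s).toMeasure

instance : IsMarkovKernel π.stepKernel :=
  ⟨fun s => (inferInstance : IsProbabilityMeasure (π.next s).toMeasure)⟩

/-- The same kernel, as a function of the history up to time `t`. -/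
def histKernel (t : ℕ) : Kernel (∀ _ : Finset.Iic t, S) S :=
  π.stepKernel.comap (fun h => h ⟨t, Finset.mem_Iic.2 le_rfl⟩) (measurable_pi_apply _)

instance (t : ℕ) : IsMarkovKernel (π.histKernel t) := by
  unfold histKernel; infer_instance

/-- The distribution of the state path `s₀ s₁ s₂ …` under `π`. -/
def pathLaw : Measure (ℕ → S) :=
  Kernel.trajMeasure (X := fun _ => S) (Measure.dirac M.s₀) π.histKernel

instance : IsProbabilityMeasure π.pathLaw := by
  unfold pathLaw; infer_instance

/-- The Kullback-Leibler divergence between two policies: that of their path distributions. -/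
def kl (π₁ π₂ : StationaryPolicy M) : ℝ≥0∞ :=
  InformationTheory.klDiv π₁.pathLaw π₂.pathLaw

/-- The occupancy measure of a state-action pair, possibly infinite. -/
def occ (s : S) (a : A) : ℝ≥0∞ :=
  ∑' t : ℕ, π.pathLaw {ξ | ξ t = s} * ENNReal.ofReal (π.prob s a)

/-- The occupancy measures as a real vector (meaningful where they are finite). -/
def occVec (s : S) (a : A) : ℝ := (π.occ s a).toReal

end Paths

/-- `q` is accessible from `s` in the Markov chain induced by `π`. -/
def Accessible (s q : S) : Prop := Relation.ReflTransGen (fun u v => 0 < π.trans u v) s q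

/-- A communicating class: all the states that communicate with a given one. -/
def IsCommClass (C : Set S) : Prop :=
  ∃ s, C = {q | π.Accessible s q ∧ π.Accessible q s}

/-- A set that the chain cannot leave. -/
def IsClosedSet (C : Set S) : Prop := ∀ s ∈ C, ∀ q, 0 < π.trans s q → q ∈ C

/-- The union of the closed communicating classes of the chain induced by `π`. -/
def closedClasses : Set S := ⋃₀ {C | π.IsCommClass C ∧ π.IsClosedSet C}

/-- The states on which a deceptive policy may deviate from the reference policy `π`. -/
def devStates (R : Set S) : Set S := (π.closedClasses ∪ R)ᶜ

end StationaryPolicy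

/-! Vectors `x s a` of occupancy measures. Only the entries with `s` in the set `D` of deviation
states and `a ∈ M.act s` are ever used. -/
namespace Occupancy

variable {S A : Type*} [Fintype S]

/-- `x_s = ∑_a x_{s,a}`. -/
def total (M : MDP S A) (x : S → A → ℝ) (s : S) : ℝ := ∑ a ∈ M.act s, x s a

/-- The occupancy flow `x_{s,q}`. -/
def flow (M : MDP S A) (x : S → A → ℝ) (s q : S) : ℝ := ∑ a ∈ M.act s, x s a * M.P s a q

/-- `u log (u / v)` for `u, v ≥ 0`, with `0 log (0 / v) = 0`, and `u log (u / 0) = ∞` for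
`u > 0`. -/
def klTerm (u v : ℝ) : EReal :=
  open Classical in
  if u = 0 then 0 else if v = 0 then ⊤ else ((u * Real.log (u / v) : ℝ) : EReal)

/-- The KL divergence from the reference policy `πS` as a function of the occupancy measures. -/
def kl {M : MDP S A} (x : S → A → ℝ) (πS : StationaryPolicy M) (D : Set S) : EReal :=
  open Classical in
  ∑ s with s ∈ D, ∑ q with q ∈ M.succ s, klTerm (flow M x s q) (πS.trans s q * total M x s)

/-- The net occupancy flow at `s`. -/
def netFlow (M : MDP S A) (x : S → A → ℝ) (D : Set S) (s : S) : ℝ :=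
  open Classical in
  total M x s - (∑ q with q ∈ D, flow M x q s) - (if s = M.s₀ then 1 else 0)

/-- The reachability probability of `R` as a function of the occupancy measures. -/
def reach (M : MDP S A) (x : S → A → ℝ) (D R : Set S) : ℝ :=
  open Classical in
  ∑ q with q ∈ R, ((∑ s with s ∈ D, flow M x s q) + (if q = M.s₀ then 1 else 0))

end Occupancy

section Team

variable {n : ℕ} {S A : Fin n → Type*} [∀ i, Fintype (S i)] {M : ∀ i, MDP (S i) (A i)}

section Policies

variable [∀ i, MeasurableSpace (S i)] [∀ i, MeasurableSingletonClass (S i)]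

/-- The probability that at least one agent `i` reaches `R i`, the agents being run independently
with the policies `π i`. -/
def disjReachProb (π : ∀ i, StationaryPolicy (M i)) (R : ∀ i, Set (S i)) : ℝ :=
  (Measure.pi fun i => (π i).pathLaw).real {ξ | ∃ i, ∃ t, ξ i t ∈ R i}

/-- Worst KL divergence of an agent's policy from its reference policy. -/
def worstKL (π πS : ∀ i, StationaryPolicy (M i)) : EReal :=
  ⨆ i, (((π i).kl (πS i) : ℝ≥0∞) : EReal)

/-- Optimal value of worst-case deceptive policy synthesis (`⊤` if infeasible). -/
def policyValue (πS : ∀ i, StationaryPolicy (M i)) (R : ∀ i, Set (S i)) (ν : ℝ) : EReal :=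
  ⨅ (π : ∀ i, StationaryPolicy (M i)) (_ : ν ≤ disjReachProb π R), worstKL π πS

end Policies

/-- Feasibility in the occupancy-measure formulation. -/
structure OccFeasible (πS : ∀ i, StationaryPolicy (M i)) (R : ∀ i, Set (S i)) (ν : ℝ)
    (x : ∀ i, S i → A i → ℝ) : Prop where
  flow_eq : ∀ i, ∀ s ∈ (πS i).devStates (R i),
    Occupancy.netFlow (M i) (x i) ((πS i).devStates (R i)) s = 0
  reach_le : ∏ i, (1 - Occupancy.reach (M i) (x i) ((πS i).devStates (R i)) (R i)) ≤ 1 - ν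
  nonneg : ∀ i, ∀ s ∈ (πS i).devStates (R i), ∀ a ∈ (M i).act s, 0 ≤ x i s a

/-- Objective of the occupancy-measure formulation. -/
def occObjective (πS : ∀ i, StationaryPolicy (M i)) (R : ∀ i, Set (S i))
    (x : ∀ i, S i → A i → ℝ) : EReal :=
  ⨆ i, Occupancy.kl (x i) (πS i) ((πS i).devStates (R i))

/-- Optimal value of the occupancy-measure formulation (`⊤` if infeasible). -/
def occValue (πS : ∀ i, StationaryPolicy (M i)) (R : ∀ i, Set (S i)) (ν : ℝ) : EReal :=
  ⨅ (x : ∀ i, S i → A i → ℝ) (_ : OccFeasible πS R ν x), occObjective πS R x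

end Team

end

/-!
The agents interact only through the product of the probabilities of missing the target sets
(`disjReachProb_eq`), so policies and occupancy measures can be converted into each other agent by
agent, preserving the reachability probability and not increasing the divergence. Fix one agent,
with reference policy `πS`, and let `D` be its set of deviation states.

*From policies to occupancy measures.* Let `π` have finite divergence from `πS`. At the states that
`π` visits, its transitions are then possible under `πS` (`TransAC`), so `D` is entered from `D`
only, and `R` from `D` only, as a closed communicating class that contains an absorbing state is a
singleton. The expected time spent in `D` is finite (`summable_visit`): the occupancy measures
truncated at time `T` have divergence at most `kl` and net flow at most `1`, and
`exists_pos_mul_sum_le` bounds a flow out of `D` by the sum of the two. That estimate is proved by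
compactness and homogeneity. If divergence and net flow both vanished on a nonzero flow, its
support would be a nonempty subset of `D` closed under `πS`, hence would contain a closed
communicating class. In the limit `T → ∞` the occupancy measures satisfy the flow equation, have
the reachability probability of `π` (`TransAC.reach_occVec_eq`) and have at most its divergence
(`kl_occVec_le`). The last point rests on `sum_stepKL_le_kl`: the divergence of the path laws
dominates that of the first `T` transitions.

*From occupancy measures to policies.* Given `x` of finite divergence, `ofOccupancy` chooses actions
in `D` in proportion to `x` and follows `πS` elsewhere. Its occupancy measures are the least
nonnegative solution of the flow equation, so they are at most `x`, and the excess is a circulation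
inside `D`, which contributes a nonnegative divergence and does not reach `R`
(`exists_policy_of_occupancy`). As the policy deviates from `πS` only in `D`, where it spends a
finite time, the likelihood ratio along a path is eventually constant and is the density of the path
law; its expected logarithm is the divergence (`kl_of_summable`).

*Attainment.* By the same coercivity estimate the sublevel sets of the occupancy problem are
bounded, and on flows along transitions that are possible under `πS` its objective is continuous, so
a minimiser exists (`exists_occObjective_eq_occValue`). The policies built from it are optimal, and
so are their occupancy measures.
-/

/-! ### The path law of a stationary policy -/

namespace StationaryPolicy

variable {S A : Type*} [Fintype S] {M : MDP S A}

/-- The likelihood ratio of the first `T` transitions under `π` and under `ρ`. -/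
noncomputable def likelihood (π ρ : StationaryPolicy M) (T : ℕ) (ξ : ℕ → S) : ℝ :=
  ∏ t ∈ Finset.range T, π.trans (ξ t) (ξ (t + 1)) / ρ.trans (ξ t) (ξ (t + 1))

lemma likelihood_nonneg (π ρ : StationaryPolicy M) (T : ℕ) (ξ : ℕ → S) :
    0 ≤ π.likelihood ρ T ξ :=
  Finset.prod_nonneg fun _ _ => div_nonneg (π.trans_nonneg _ _) (ρ.trans_nonneg _ _)

variable [MeasurableSpace S] [MeasurableSingletonClass S]

open Preorder in
/-- The Markov property: given the path up to time `T`, the next state has law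
`π.trans (ξ T)`. -/
lemma lintegral_pathLaw_succ (π : StationaryPolicy M) (T : ℕ)
    (G : (Finset.Iic T → S) × S → ℝ≥0∞) :
    ∫⁻ ξ, G (frestrictLe (π := fun _ => S) T ξ, ξ (T + 1)) ∂π.pathLaw =
      ∫⁻ ξ, ∑ q, ENNReal.ofReal (π.trans (ξ T) q) *
        G (frestrictLe (π := fun _ => S) T ξ, q) ∂π.pathLaw := by
  have hG : Measurable G := Measurable.of_discrete
  have h1 := Kernel.map_frestrictLe_trajMeasure_compProd_eq_map_trajMeasure
    (X := fun _ => S) (μ₀ := Measure.dirac M.s₀) (κ := π.histKernel) (a := T)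
  have hm : Measurable fun ξ : ℕ → S => (frestrictLe (π := fun _ => S) T ξ, ξ (T + 1)) := by
    fun_prop
  calc _ = ∫⁻ z, G z ∂(π.pathLaw.map fun ξ => (frestrictLe (π := fun _ => S) T ξ, ξ (T + 1))) := by
        rw [lintegral_map hG hm]
    _ = ∫⁻ z, G z ∂((π.pathLaw.map (frestrictLe (π := fun _ => S) T)) ⊗ₘ π.histKernel T) := by
        unfold pathLaw; rw [h1]
    _ = ∫⁻ h, ∫⁻ q, G (h, q) ∂(π.histKernel T h)
          ∂(π.pathLaw.map (frestrictLe (π := fun _ => S) T)) := by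
        rw [Measure.lintegral_compProd hG]
    _ = _ := by
        rw [lintegral_map Measurable.of_discrete (by fun_prop)]
        refine lintegral_congr fun ξ => ?_
        rw [lintegral_fintype]
        refine Finset.sum_congr rfl fun q _ => ?_
        rw [mul_comm]
        congr 1
        have : π.histKernel T (frestrictLe (π := fun _ => S) T ξ) = (π.next (ξ T)).toMeasure := rfl
        rw [this, PMF.toMeasure_apply_singleton _ _ (measurableSet_singleton q)]
        rfl

lemma pathLaw_map_zero (π : StationaryPolicy M) :
    π.pathLaw.map (fun ξ => ξ 0) = Measure.dirac M.s₀ := by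
  have h : π.pathLaw.map (Preorder.frestrictLe (π := fun _ => S) 0) =
      (Measure.dirac M.s₀).map (MeasurableEquiv.piUnique fun _ : Finset.Iic 0 => S).symm := by
    unfold pathLaw Kernel.trajMeasure
    rw [Measure.map_comp _ _ (by fun_prop), Kernel.traj_map_frestrictLe, Kernel.partialTraj_self,
      Measure.id_comp]
  have h2 : π.pathLaw.map (fun ξ => ξ 0) =
      (π.pathLaw.map (Preorder.frestrictLe (π := fun _ => S) 0)).map
        (fun h => h ⟨0, Finset.mem_Iic.2 le_rfl⟩) := by
    rw [Measure.map_map (by fun_prop) (by fun_prop)]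
    rfl
  rw [h2, h, Measure.map_map (by fun_prop) (by fun_prop)]
  exact Measure.map_id

/-- The probability of being in `s` at time `t`. -/
noncomputable def visit (π : StationaryPolicy M) (t : ℕ) (s : S) : ℝ :=
  π.pathLaw.real {ξ | ξ t = s}

lemma visit_nonneg (π : StationaryPolicy M) (t : ℕ) (s : S) : 0 ≤ π.visit t s :=
  measureReal_nonneg

lemma measurableSet_path (p : S → Prop) (t : ℕ) : MeasurableSet {ξ : ℕ → S | p (ξ t)} :=
  (measurable_pi_apply (X := fun _ : ℕ => S) t) (MeasurableSet.of_discrete (s := {s | p s}))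

lemma measurableSet_path₂ (p : S → S → Prop) (t u : ℕ) :
    MeasurableSet {ξ : ℕ → S | p (ξ t) (ξ u)} :=
  (show Measurable fun ξ : ℕ → S => (ξ t, ξ u) by fun_prop)
    (MeasurableSet.of_discrete (s := {z : S × S | p z.1 z.2}))

open Classical in
lemma visit_zero (π : StationaryPolicy M) (s : S) :
    π.visit 0 s = if s = M.s₀ then 1 else 0 := by
  have h : π.pathLaw {ξ | ξ 0 = s} = (Measure.dirac M.s₀) {s} := by
    rw [← pathLaw_map_zero π, Measure.map_apply (by fun_prop) (measurableSet_singleton s)]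
    rfl
  rw [visit, Measure.real, h, Measure.dirac_apply' _ (measurableSet_singleton s)]
  by_cases hs : s = M.s₀
  · simp [hs]
  · simp [hs, Ne.symm hs]

open Classical in
lemma pathLaw_real_step (π : StationaryPolicy M) (t : ℕ) (s q : S) :
    π.pathLaw.real {ξ | ξ t = s ∧ ξ (t + 1) = q} = π.visit t s * π.trans s q := by
  have h := π.lintegral_pathLaw_succ t fun z =>
    if z.1 ⟨t, Finset.mem_Iic.2 le_rfl⟩ = s ∧ z.2 = q then 1 else 0
  have e1 : ∫⁻ ξ, (if ξ t = s ∧ ξ (t + 1) = q then 1 else 0) ∂π.pathLaw =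
      π.pathLaw {ξ | ξ t = s ∧ ξ (t + 1) = q} := by
    rw [← lintegral_indicator_one (measurableSet_path₂ (fun u v => u = s ∧ v = q) t (t + 1))]
    refine lintegral_congr fun ξ => ?_
    simp [Set.indicator_apply]
  have e2 : ∫⁻ ξ, (∑ q', ENNReal.ofReal (π.trans (ξ t) q') *
      (if ξ t = s ∧ q' = q then 1 else 0)) ∂π.pathLaw =
      π.pathLaw {ξ | ξ t = s} * ENNReal.ofReal (π.trans s q) := by
    rw [mul_comm, ← lintegral_indicator_const (measurableSet_path (fun u => u = s) t)]
    refine lintegral_congr fun ξ => ?_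
    by_cases hs : ξ t = s <;> simp [hs]
  have h' : π.pathLaw {ξ | ξ t = s ∧ ξ (t + 1) = q} =
      π.pathLaw {ξ | ξ t = s} * ENNReal.ofReal (π.trans s q) := e1.symm.trans (h.trans e2)
  rw [Measure.real, h', ENNReal.toReal_mul, ENNReal.toReal_ofReal (π.trans_nonneg s q)]
  rfl

lemma integral_visit (π : StationaryPolicy M) (t : ℕ) (f : S → ℝ) :
    ∫ ξ, f (ξ t) ∂π.pathLaw = ∑ s, π.visit t s * f s := by
  rw [← integral_map (μ := π.pathLaw) (φ := fun ξ : ℕ → S => ξ t) (f := f)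
      (measurable_pi_apply t).aemeasurable Measurable.of_discrete.aestronglyMeasurable]
  have : IsProbabilityMeasure (π.pathLaw.map fun ξ : ℕ → S => ξ t) :=
    Measure.isProbabilityMeasure_map (measurable_pi_apply t).aemeasurable
  rw [integral_fintype (Integrable.of_finite)]
  refine Finset.sum_congr rfl fun s _ => ?_
  rw [map_measureReal_apply (by fun_prop) (measurableSet_singleton s)]
  rfl

lemma integral_step (π : StationaryPolicy M) (t : ℕ) (f : S → S → ℝ) :
    ∫ ξ, f (ξ t) (ξ (t + 1)) ∂π.pathLaw = ∑ s, ∑ q, π.visit t s * π.trans s q * f s q := by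
  rw [← integral_map (μ := π.pathLaw) (φ := fun ξ : ℕ → S => (ξ t, ξ (t + 1)))
      (f := fun z : S × S => f z.1 z.2)
      (by fun_prop) (Measurable.of_discrete.aestronglyMeasurable)]
  have : IsProbabilityMeasure (π.pathLaw.map fun ξ : ℕ → S => (ξ t, ξ (t + 1))) :=
    Measure.isProbabilityMeasure_map (by fun_prop)
  rw [integral_fintype (Integrable.of_finite), Fintype.sum_prod_type]
  refine Finset.sum_congr rfl fun s _ => Finset.sum_congr rfl fun q _ => ?_
  rw [map_measureReal_apply (by fun_prop) (measurableSet_singleton _), ← pathLaw_real_step,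
    smul_eq_mul]
  congr 3
  ext ξ
  simp

lemma integrable_path (π : StationaryPolicy M) (t u : ℕ) (f : S → S → ℝ) :
    Integrable (fun ξ : ℕ → S => f (ξ t) (ξ u)) π.pathLaw := by
  have : IsProbabilityMeasure (π.pathLaw.map fun ξ : ℕ → S => (ξ t, ξ u)) :=
    Measure.isProbabilityMeasure_map (by fun_prop)
  exact (Integrable.of_finite (f := fun z : S × S => f z.1 z.2)
    (μ := π.pathLaw.map fun ξ : ℕ → S => (ξ t, ξ u))).comp_measurable (by fun_prop)

lemma visit_le_one (π : StationaryPolicy M) (t : ℕ) (s : S) : π.visit t s ≤ 1 :=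
  measureReal_le_one

lemma visit_succ (π : StationaryPolicy M) (t : ℕ) (q : S) :
    π.visit (t + 1) q = ∑ s, π.visit t s * π.trans s q := by
  classical
  have h1 := π.integral_visit (t + 1) fun u => if u = q then 1 else 0
  have h2 := π.integral_step t fun _ u => if u = q then 1 else 0
  simp only [mul_ite, mul_one, mul_zero, Finset.sum_ite_eq', Finset.mem_univ, if_true] at h1 h2
  rw [← h1, h2]

lemma ae_visit_pos (π : StationaryPolicy M) :
    ∀ᵐ ξ ∂π.pathLaw, ∀ t, 0 < π.visit t (ξ t) := by
  rw [ae_all_iff]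
  intro t
  have h : ∀ s, ∀ᵐ ξ ∂π.pathLaw, ξ t = s → 0 < π.visit t s := by
    intro s
    by_cases hs : 0 < π.visit t s
    · simp [hs]
    · have h0 : π.visit t s = 0 := le_antisymm (not_lt.1 hs) (π.visit_nonneg t s)
      rw [visit, measureReal_eq_zero_iff] at h0
      filter_upwards [measure_eq_zero_iff_ae_notMem.1 h0] with ξ h1 h2
      exact absurd h2 h1
  filter_upwards [ae_all_iff.2 h] with ξ h1 using h1 _ rfl

lemma ae_trans_pos (π : StationaryPolicy M) :
    ∀ᵐ ξ ∂π.pathLaw, ∀ t, 0 < π.trans (ξ t) (ξ (t + 1)) := by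
  rw [ae_all_iff]
  intro t
  have h : ∀ s q, ∀ᵐ ξ ∂π.pathLaw, ξ t = s ∧ ξ (t + 1) = q → 0 < π.trans s q := by
    intro s q
    by_cases hs : 0 < π.trans s q
    · simp [hs]
    · have h0 := π.pathLaw_real_step t s q
      rw [le_antisymm (not_lt.1 hs) (π.trans_nonneg s q), mul_zero, measureReal_eq_zero_iff] at h0
      filter_upwards [measure_eq_zero_iff_ae_notMem.1 h0] with ξ h1 h2
      exact absurd h2 h1
  filter_upwards [ae_all_iff.2 fun s => ae_all_iff.2 (h s)] with ξ h1 using h1 _ _ ⟨rfl, rfl⟩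

lemma measurable_likelihood (π ρ : StationaryPolicy M) (T : ℕ) :
    Measurable (π.likelihood ρ T) := by
  unfold likelihood
  refine Finset.measurable_prod _ fun t _ => ?_
  exact (Measurable.of_discrete (f := fun z : S × S => π.trans z.1 z.2 / ρ.trans z.1 z.2)).comp
    (show Measurable fun ξ : ℕ → S => (ξ t, ξ (t + 1)) by fun_prop)

/-- At every state that `π` visits, the next state under `π` is a possible next state under
`ρ`. -/
def TransAC (π ρ : StationaryPolicy M) : Prop :=
  ∀ t s q, 0 < π.visit t s → 0 < π.trans s q → 0 < ρ.trans s q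

lemma TransAC.likelihood_pos {π ρ : StationaryPolicy M} (h : π.TransAC ρ) :
    ∀ᵐ ξ ∂π.pathLaw, ∀ T, 0 < π.likelihood ρ T ξ := by
  filter_upwards [π.ae_visit_pos, π.ae_trans_pos] with ξ h1 h2 T
  exact Finset.prod_pos fun t _ => div_pos (h2 t) (h t _ _ (h1 t) (h2 t))

/-- Up to time `T` the likelihood ratio is the density of the path law. -/
lemma TransAC.lintegral_likelihood {π ρ : StationaryPolicy M} (hac : π.TransAC ρ) (T : ℕ)
    (g : (Finset.Iic T → S) → ℝ≥0∞) :
    ∫⁻ ξ, g (Preorder.frestrictLe (π := fun _ => S) T ξ) ∂π.pathLaw =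
      ∫⁻ ξ, ENNReal.ofReal (π.likelihood ρ T ξ) *
        g (Preorder.frestrictLe (π := fun _ => S) T ξ) ∂ρ.pathLaw := by
  classical
  induction T with
  | zero =>
    have key : ∀ σ : StationaryPolicy M,
        ∫⁻ ξ, g (Preorder.frestrictLe (π := fun _ => S) 0 ξ) ∂σ.pathLaw =
          g fun _ => M.s₀ := by
      intro σ
      have e : ∀ ξ : ℕ → S, g (Preorder.frestrictLe (π := fun _ => S) 0 ξ) =
          (fun s => g fun _ => s) (ξ 0) := by
        intro ξ
        congr 1
        ext ⟨i, hi⟩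
        have : i = 0 := by simpa using hi
        subst this
        rfl
      simp_rw [e]
      rw [← lintegral_map (μ := σ.pathLaw) (f := fun s => g fun _ => s)
        (g := fun ξ : ℕ → S => ξ 0) Measurable.of_discrete (by fun_prop), pathLaw_map_zero,
        lintegral_dirac' _ Measurable.of_discrete]
    simp only [likelihood, Finset.range_zero, Finset.prod_empty, ENNReal.ofReal_one, one_mul]
    rw [key, key]
  | succ T ih =>
    -- split a history up to time `T + 1` into the history up to `T` and the last state
    let j : (Finset.Iic T → S) × S → (Finset.Iic (T + 1) → S) := fun z i =>
      if h : (i : ℕ) ≤ T then z.1 ⟨i, Finset.mem_Iic.2 h⟩ else z.2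
    have hj : ∀ ξ : ℕ → S, Preorder.frestrictLe (π := fun _ => S) (T + 1) ξ =
        j (Preorder.frestrictLe (π := fun _ => S) T ξ, ξ (T + 1)) := by
      intro ξ
      ext ⟨i, hi⟩
      simp only [Finset.mem_Iic] at hi
      by_cases h : i ≤ T
      · simp [j, h]
      · have : i = T + 1 := by omega
        subst this
        simp [j]
    let r : S → S → ℝ≥0∞ := fun s q => ENNReal.ofReal (π.trans s q / ρ.trans s q)
    -- extend a history up to time `T` to a path, so that `likelihood` can be evaluated on it
    let e : (Finset.Iic T → S) → ℕ → S := fun h t =>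
      h ⟨min t T, Finset.mem_Iic.2 (min_le_right t T)⟩
    have he : ∀ ξ : ℕ → S, ENNReal.ofReal (π.likelihood ρ T ξ) = ENNReal.ofReal
        (π.likelihood ρ T (e (Preorder.frestrictLe (π := fun _ => S) T ξ))) := by
      intro ξ
      congr 1
      refine Finset.prod_congr rfl fun t ht => ?_
      have ht' : t < T := Finset.mem_range.1 ht
      simp [e, min_eq_left ht'.le, min_eq_left (Nat.succ_le_of_lt ht')]
    have hS : ∀ ξ : ℕ → S, ENNReal.ofReal (π.likelihood ρ (T + 1) ξ) =
        ENNReal.ofReal (π.likelihood ρ T ξ) * r (ξ T) (ξ (T + 1)) := by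
      intro ξ
      have h : π.likelihood ρ (T + 1) ξ = π.likelihood ρ T ξ *
          (π.trans (ξ T) (ξ (T + 1)) / ρ.trans (ξ T) (ξ (T + 1))) := Finset.prod_range_succ _ _
      rw [h, ENNReal.ofReal_mul (π.likelihood_nonneg ρ T ξ)]
    have hr : ∀ᵐ ξ ∂π.pathLaw, ∀ q, ENNReal.ofReal (π.trans (ξ T) q) =
        ENNReal.ofReal (ρ.trans (ξ T) q) * r (ξ T) q := by
      filter_upwards [π.ae_visit_pos] with ξ h1 q
      rw [← ENNReal.ofReal_mul (ρ.trans_nonneg _ _)]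
      congr 1
      rcases (ρ.trans_nonneg (ξ T) q).eq_or_lt with h0 | h0
      · rw [← h0, zero_mul]
        by_contra hne
        exact h0.not_lt (hac T _ _ (h1 T) (lt_of_le_of_ne (π.trans_nonneg _ _) (Ne.symm hne)))
      · rw [mul_div_cancel₀ _ h0.ne']
    let G : (Finset.Iic T → S) → ℝ≥0∞ := fun h => ∑ q, ENNReal.ofReal
      (ρ.trans (h ⟨T, Finset.mem_Iic.2 le_rfl⟩) q) *
        (r (h ⟨T, Finset.mem_Iic.2 le_rfl⟩) q * g (j (h, q)))
    let H : (Finset.Iic T → S) × S → ℝ≥0∞ := fun z =>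
      ENNReal.ofReal (π.likelihood ρ T (e z.1)) *
        (r (z.1 ⟨T, Finset.mem_Iic.2 le_rfl⟩) z.2 * g (j z))
    calc _ = ∫⁻ ξ, ∑ q, ENNReal.ofReal (π.trans (ξ T) q) *
          g (j (Preorder.frestrictLe (π := fun _ => S) T ξ, q)) ∂π.pathLaw := by
          simp_rw [hj]
          exact π.lintegral_pathLaw_succ T fun z => g (j z)
      _ = ∫⁻ ξ, G (Preorder.frestrictLe (π := fun _ => S) T ξ) ∂π.pathLaw := by
          refine lintegral_congr_ae ?_
          filter_upwards [hr] with ξ h1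
          refine Finset.sum_congr rfl fun q _ => ?_
          rw [h1 q, mul_assoc]
          rfl
      _ = ∫⁻ ξ, ENNReal.ofReal (π.likelihood ρ T ξ) *
          G (Preorder.frestrictLe (π := fun _ => S) T ξ) ∂ρ.pathLaw := ih G
      _ = ∫⁻ ξ, ∑ q, ENNReal.ofReal (ρ.trans (ξ T) q) * H
            (Preorder.frestrictLe (π := fun _ => S) T ξ, q) ∂ρ.pathLaw := by
          refine lintegral_congr fun ξ => ?_
          rw [he ξ]
          simp only [G, Finset.mul_sum]
          refine Finset.sum_congr rfl fun q _ => ?_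
          rw [mul_left_comm]
          rfl
      _ = _ := by
          refine (ρ.lintegral_pathLaw_succ T H).symm.trans ?_
          refine lintegral_congr fun ξ => ?_
          rw [hS ξ, he ξ, hj ξ, mul_assoc]
          rfl

end StationaryPolicy

/-! ### Kullback-Leibler divergence of path laws -/

namespace StationaryPolicy

variable {S A : Type*} [Fintype S] {M : MDP S A}

/-- The KL divergence of the next-state law of `π` at `s` from that of `ρ`, as a real number
(meaningful where the former is absolutely continuous with respect to the latter). -/
noncomputable def stepKL (π ρ : StationaryPolicy M) (s : S) : ℝ :=
  ∑ q, π.trans s q * Real.log (π.trans s q / ρ.trans s q)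

lemma trans_ratio_eq_one {π ρ : StationaryPolicy M} {D : Set S}
    (hoff : ∀ s ∉ D, ∀ q, π.trans s q = ρ.trans s q) {ξ : ℕ → S} {T t : ℕ}
    (h : ∀ t, 0 < ρ.trans (ξ t) (ξ (t + 1))) (hT : ∀ t, T ≤ t → ξ t ∉ D) (ht : T ≤ t) :
    π.trans (ξ t) (ξ (t + 1)) / ρ.trans (ξ t) (ξ (t + 1)) = 1 := by
  rw [hoff _ (hT t ht), div_self (h t).ne']

variable [MeasurableSpace S] [MeasurableSingletonClass S]

lemma TransAC.of_absolutelyContinuous {π ρ : StationaryPolicy M}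
    (h : π.pathLaw ≪ ρ.pathLaw) : π.TransAC ρ := by
  intro t s q hs hq
  by_contra hn
  have h0 := ρ.pathLaw_real_step t s q
  rw [le_antisymm (not_lt.1 hn) (ρ.trans_nonneg s q), mul_zero, measureReal_eq_zero_iff] at h0
  have h1 := π.pathLaw_real_step t s q
  rw [Measure.real, h h0, ENNReal.toReal_zero] at h1
  exact (mul_pos hs hq).ne h1

lemma integral_log_ratio (π ρ : StationaryPolicy M) (t : ℕ) :
    ∫ ξ, Real.log (π.trans (ξ t) (ξ (t + 1)) / ρ.trans (ξ t) (ξ (t + 1))) ∂π.pathLaw =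
      ∑ s, π.visit t s * π.stepKL ρ s := by
  rw [π.integral_step t fun s q => Real.log (π.trans s q / ρ.trans s q)]
  simp only [stepKL, Finset.mul_sum, mul_assoc]

lemma TransAC.log_likelihood {π ρ : StationaryPolicy M} (h : π.TransAC ρ) :
    ∀ᵐ ξ ∂π.pathLaw, ∀ T, Real.log (π.likelihood ρ T ξ) =
      ∑ t ∈ Finset.range T, Real.log (π.trans (ξ t) (ξ (t + 1)) / ρ.trans (ξ t) (ξ (t + 1))) := by
  filter_upwards [π.ae_visit_pos, π.ae_trans_pos] with ξ h1 h2 T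
  exact Real.log_prod fun t _ => (div_pos (h2 t) (h t _ _ (h1 t) (h2 t))).ne'

/-- The divergence of the path laws dominates that of the first `T` transitions: integrate
`log z ≤ z - 1` for `z` the quotient of the likelihood ratio by the density of the path laws. -/
lemma sum_stepKL_le_kl {π ρ : StationaryPolicy M} (h : π.kl ρ ≠ ⊤) (T : ℕ) :
    ∑ t ∈ Finset.range T, ∑ s, π.visit t s * π.stepKL ρ s ≤ (π.kl ρ).toReal := by
  obtain ⟨hac, hint⟩ := InformationTheory.klDiv_ne_top_iff.1 h
  have hT := TransAC.of_absolutelyContinuous hac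
  set μ := π.pathLaw with hμ
  set ν := ρ.pathLaw with hν
  rw [kl, InformationTheory.toReal_klDiv_of_measure_eq hac (by simp)]
  let Z : (ℕ → S) → ℝ≥0∞ := fun ξ => ENNReal.ofReal (π.likelihood ρ T ξ) / μ.rnDeriv ν ξ
  have hZm : Measurable Z :=
    ((π.measurable_likelihood ρ T).ennreal_ofReal).div (Measure.measurable_rnDeriv μ ν)
  have hL1 : ∫⁻ ξ, ENNReal.ofReal (π.likelihood ρ T ξ) ∂ν = 1 := by
    have := hT.lintegral_likelihood T fun _ => 1
    simpa using this.symm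
  have hZ1 : ∫⁻ ξ, Z ξ ∂μ ≤ 1 := by
    conv_lhs => rw [← Measure.withDensity_rnDeriv_eq μ ν hac]
    rw [lintegral_withDensity_eq_lintegral_mul ν (Measure.measurable_rnDeriv μ ν) hZm, ← hL1]
    exact lintegral_mono fun ξ => ENNReal.mul_div_le
  have hZr : Integrable (fun ξ => (Z ξ).toReal) μ :=
    integrable_toReal_of_lintegral_ne_top hZm.aemeasurable (hZ1.trans_lt ENNReal.one_lt_top).ne
  have hZr1 : ∫ ξ, (Z ξ).toReal ∂μ ≤ 1 := by
    rw [integral_toReal hZm.aemeasurable (ae_lt_top hZm (hZ1.trans_lt ENNReal.one_lt_top).ne)]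
    exact ENNReal.toReal_le_of_le_ofReal zero_le_one (by simpa using hZ1)
  have hlog : ∀ t, Integrable (fun ξ : ℕ → S =>
      Real.log (π.trans (ξ t) (ξ (t + 1)) / ρ.trans (ξ t) (ξ (t + 1)))) μ := fun t =>
    π.integrable_path t (t + 1) fun s q => Real.log (π.trans s q / ρ.trans s q)
  have hZ2 : Integrable (fun ξ => (Z ξ).toReal - 1) μ := hZr.sub (integrable_const 1)
  calc _ = ∫ ξ, ∑ t ∈ Finset.range T,
        Real.log (π.trans (ξ t) (ξ (t + 1)) / ρ.trans (ξ t) (ξ (t + 1))) ∂μ := by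
        rw [integral_finsetSum _ fun t _ => hlog t]
        exact Finset.sum_congr rfl fun t _ => (integral_log_ratio π ρ t).symm
    _ ≤ ∫ ξ, (llr μ ν ξ + ((Z ξ).toReal - 1)) ∂μ := by
        refine integral_mono_ae (integrable_finsetSum _ fun t _ => hlog t)
          (hint.add hZ2) ?_
        filter_upwards [hT.log_likelihood, hT.likelihood_pos, Measure.rnDeriv_pos hac,
          hac.ae_le (Measure.rnDeriv_lt_top μ ν)] with ξ h1 h2 h3 h4
        have hd : 0 < (μ.rnDeriv ν ξ).toReal := ENNReal.toReal_pos h3.ne' h4.ne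
        have hz : (Z ξ).toReal = π.likelihood ρ T ξ / (μ.rnDeriv ν ξ).toReal := by
          rw [ENNReal.toReal_div, ENNReal.toReal_ofReal (h2 T).le]
        have := Real.log_le_sub_one_of_pos (div_pos (h2 T) hd)
        rw [Real.log_div (h2 T).ne' hd.ne'] at this
        rw [← h1 T, hz, llr]
        linarith
    _ = ∫ ξ, llr μ ν ξ ∂μ + (∫ ξ, (Z ξ).toReal ∂μ - 1) := by
        rw [integral_add hint hZ2, integral_sub hZr (integrable_const 1)]
        simp
    _ ≤ _ := by linarith

lemma ae_notMem_of_le {ρ : StationaryPolicy M} {D : Set S}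
    (hD : ∀ s ∉ D, ∀ q ∈ D, ρ.trans s q = 0) :
    ∀ᵐ ξ ∂ρ.pathLaw, ∀ T, ξ T ∉ D → ∀ t, T ≤ t → ξ t ∉ D := by
  filter_upwards [ρ.ae_trans_pos] with ξ h T hT t ht
  induction t, ht using Nat.le_induction with
  | base => exact hT
  | succ t _ ih => exact fun hq => (h t).ne' (hD _ ih _ hq)

/-- If `π` and `ρ` have the same transitions outside `D`, and `D` cannot be entered from outside,
then among the paths that are outside `D` at time `T` the likelihood ratio of the first `T`
transitions is a density on the whole path. -/
lemma restrict_eq_withDensity {π ρ : StationaryPolicy M} {D : Set S} (hac : π.TransAC ρ)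
    (hoff : ∀ s ∉ D, ∀ q, π.trans s q = ρ.trans s q)
    (hD : ∀ s ∉ D, ∀ q ∈ D, ρ.trans s q = 0) (T : ℕ) :
    π.pathLaw.restrict {ξ | ξ T ∉ D} =
      (ρ.pathLaw.restrict {ξ | ξ T ∉ D}).withDensity
        fun ξ => ENNReal.ofReal (π.likelihood ρ T ξ) := by
  classical
  have hmD : MeasurableSet {ξ : ℕ → S | ξ T ∉ D} := measurableSet_path (fun s => s ∉ D) T
  have hLm := (π.measurable_likelihood ρ T).ennreal_ofReal
  have key : ∀ t ∈ measurableCylinders (fun _ : ℕ => S),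
      π.pathLaw.restrict {ξ | ξ T ∉ D} t = (ρ.pathLaw.restrict {ξ | ξ T ∉ D}).withDensity
        (fun ξ => ENNReal.ofReal (π.likelihood ρ T ξ)) t := by
    intro B hB
    have hBm : MeasurableSet B := MeasurableSet.of_mem_measurableCylinders hB
    rw [measurableCylinders_nat] at hB
    simp only [Set.mem_iUnion, Set.mem_singleton_iff] at hB
    obtain ⟨a, C, -, rfl⟩ := hB
    -- the event depends on the path up to time `max a T` only
    let U := max a T
    have haU : Finset.Iic a ⊆ Finset.Iic U := Finset.Iic_subset_Iic.2 (le_max_left a T)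
    have hTU : T ∈ Finset.Iic U := Finset.mem_Iic.2 (le_max_right a T)
    let g : (Finset.Iic U → S) → ℝ≥0∞ := fun h =>
      if Finset.restrict₂ (π := fun _ => S) haU h ∈ C ∧ h ⟨T, hTU⟩ ∉ D then 1 else 0
    have hg : ∀ ξ : ℕ → S, g (Preorder.frestrictLe (π := fun _ => S) U ξ) =
        (cylinder (Finset.Iic a) C ∩ {ξ : ℕ → S | ξ T ∉ D}).indicator 1 ξ := by
      intro ξ
      rw [Set.indicator_apply]
      rfl
    rw [Measure.restrict_apply hBm, withDensity_apply _ hBm, Measure.restrict_restrict hBm,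
      ← lintegral_indicator_one (hBm.inter hmD), ← lintegral_indicator (hBm.inter hmD)]
    simp_rw [← hg]
    rw [hac.lintegral_likelihood U g]
    refine lintegral_congr_ae ?_
    filter_upwards [ae_notMem_of_le hD, ρ.ae_trans_pos] with ξ h1 h2
    rw [hg]
    by_cases hξ : ξ ∈ cylinder (Finset.Iic a) C ∩ {ξ : ℕ → S | ξ T ∉ D}
    · rw [Set.indicator_of_mem hξ, Set.indicator_of_mem hξ, Pi.one_apply, mul_one]
      congr 1
      refine (Finset.prod_subset (Finset.range_subset_range.2 (le_max_right a T)) ?_).symm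
      intro t _ ht
      exact trans_ratio_eq_one hoff h2 (h1 T hξ.2) (not_lt.1 fun h => ht (Finset.mem_range.2 h))
    · rw [Set.indicator_of_notMem hξ, Set.indicator_of_notMem hξ, mul_zero]
  refine ext_of_generate_finite _ generateFrom_measurableCylinders.symm
    isPiSystem_measurableCylinders key ?_
  exact key _ (univ_mem_measurableCylinders _)

lemma ae_exists_notMem {π : StationaryPolicy M} {D : Set S}
    (hs : ∀ s ∈ D, Summable fun t => π.visit t s) : ∀ᵐ ξ ∂π.pathLaw, ∃ T, ξ T ∉ D := by
  classical
  have hlim : Filter.Tendsto (fun t => ∑ s with s ∈ D, π.visit t s) Filter.atTop (nhds 0) := by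
    have := tendsto_finsetSum (Finset.univ.filter (· ∈ D)) fun s hs' =>
      (hs s (Finset.mem_filter.1 hs').2).tendsto_atTop_zero
    simpa using this
  have hle : ∀ T, π.pathLaw.real {ξ | ∀ T, ξ T ∈ D} ≤ ∑ s with s ∈ D, π.visit T s := by
    intro T
    calc _ ≤ π.pathLaw.real (⋃ s ∈ Finset.univ.filter (· ∈ D), {ξ | ξ T = s}) := by
          refine measureReal_mono (fun ξ hξ => ?_) (measure_ne_top _ _)
          simpa using hξ T
      _ ≤ _ := measureReal_biUnion_finset_le _ _
  have h0 : π.pathLaw.real {ξ | ∀ T, ξ T ∈ D} = 0 :=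
    le_antisymm (ge_of_tendsto' hlim hle) measureReal_nonneg
  rw [measureReal_eq_zero_iff] at h0
  filter_upwards [measure_eq_zero_iff_ae_notMem.1 h0] with ξ hξ
  by_contra! hn
  exact hξ hn

/-- Two policies that differ only on a set `D` in which `π` spends a finite expected time, and that
cannot be entered from outside: the path law of `π` has the eventually constant likelihood ratio as
its density, and the divergence is the sum of the expected divergences of the transitions. -/
lemma kl_of_summable {π ρ : StationaryPolicy M} {D : Set S}
    (hac : π.TransAC ρ) (hoff : ∀ s ∉ D, ∀ q, π.trans s q = ρ.trans s q)
    (hD : ∀ s ∉ D, ∀ q ∈ D, ρ.trans s q = 0) (hs : ∀ s ∈ D, Summable fun t => π.visit t s) :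
    π.kl ρ ≠ ⊤ ∧ HasSum (fun t => ∑ s, π.visit t s * π.stepKL ρ s) (π.kl ρ).toReal := by
  classical
  have hex := ae_exists_notMem hs
  have hmD : ∀ T, MeasurableSet {ξ : ℕ → S | ξ T ∉ D} := measurableSet_path fun s => s ∉ D
  have hLm := fun T => (π.measurable_likelihood ρ T).ennreal_ofReal
  have hμν : π.pathLaw ≪ ρ.pathLaw := by
    refine Measure.AbsolutelyContinuous.mk fun B hB h0 => ?_
    have hT : ∀ T, π.pathLaw (B ∩ {ξ | ξ T ∉ D}) = 0 := by
      intro T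
      rw [← Measure.restrict_apply hB, restrict_eq_withDensity hac hoff hD T]
      refine withDensity_absolutelyContinuous _ _ ?_
      exact le_antisymm ((Measure.restrict_apply_le _ _).trans h0.le) zero_le
    rw [measure_eq_zero_iff_ae_notMem]
    filter_upwards [hex, ae_all_iff.2 fun T => measure_eq_zero_iff_ae_notMem.1 (hT T)] with
      ξ ⟨T, h1⟩ h2 h3
    exact h2 T ⟨h3, h1⟩
  have hdens : ∀ᵐ ξ ∂π.pathLaw, ∀ T, ξ T ∉ D →
      π.pathLaw.rnDeriv ρ.pathLaw ξ = ENNReal.ofReal (π.likelihood ρ T ξ) := by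
    rw [ae_all_iff]
    intro T
    have h : π.pathLaw.rnDeriv ρ.pathLaw =ᵐ[ρ.pathLaw.restrict {ξ | ξ T ∉ D}]
        fun ξ => ENNReal.ofReal (π.likelihood ρ T ξ) := by
      refine (withDensity_eq_iff_of_sigmaFinite (Measure.measurable_rnDeriv _ _).aemeasurable
        (hLm T).aemeasurable).1 ?_
      rw [← restrict_eq_withDensity hac hoff hD T, ← restrict_withDensity (hmD T),
        Measure.withDensity_rnDeriv_eq _ _ hμν]
    exact hμν.ae_le ((ae_restrict_iff' (hmD T)).1 h)
  let f : ℕ → (ℕ → S) → ℝ := fun t ξ =>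
    Real.log (π.trans (ξ t) (ξ (t + 1)) / ρ.trans (ξ t) (ξ (t + 1)))
  have hfi : ∀ t, Integrable (f t) π.pathLaw := fun t =>
    π.integrable_path t (t + 1) fun s q => Real.log (π.trans s q / ρ.trans s q)
  have hllr : ∀ᵐ ξ ∂π.pathLaw, ∃ T, (∀ t, T ≤ t → f t ξ = 0) ∧
      llr π.pathLaw ρ.pathLaw ξ = ∑ t ∈ Finset.range T, f t ξ := by
    filter_upwards [hex, hdens, hac.log_likelihood, hac.likelihood_pos,
      hμν.ae_le (ae_notMem_of_le hD), hμν.ae_le ρ.ae_trans_pos] with ξ ⟨T, hT⟩ h1 h2 h3 h4 h5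
    refine ⟨T, fun t ht => ?_, ?_⟩
    · simp only [f, trans_ratio_eq_one hoff h5 (h4 T hT) ht, Real.log_one]
    · rw [llr, h1 T hT, ENNReal.toReal_ofReal (h3 T).le, h2 T]
  -- off `D` the logarithm of the ratio vanishes, and on `D` it is bounded
  let c : ℝ := ∑ s, ∑ q, |Real.log (π.trans s q / ρ.trans s q)|
  have hc : ∀ s q, |Real.log (π.trans s q / ρ.trans s q)| ≤ c := fun s q =>
    (Finset.single_le_sum (f := fun q => |Real.log (π.trans s q / ρ.trans s q)|)
      (fun _ _ => abs_nonneg _) (Finset.mem_univ q)).trans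
    (Finset.single_le_sum (f := fun s => ∑ q, |Real.log (π.trans s q / ρ.trans s q)|)
      (fun _ _ => Finset.sum_nonneg fun _ _ => abs_nonneg _) (Finset.mem_univ s))
  have hnorm : ∀ t, ∫ ξ, ‖f t ξ‖ ∂π.pathLaw ≤ ∑ s with s ∈ D, c * π.visit t s := by
    intro t
    rw [show ∫ ξ, ‖f t ξ‖ ∂π.pathLaw = _ from
      π.integral_step t fun s q => ‖Real.log (π.trans s q / ρ.trans s q)‖, Finset.sum_filter]
    refine Finset.sum_le_sum fun s _ => ?_
    split_ifs with hsD
    · calc _ ≤ ∑ q, π.visit t s * π.trans s q * c := Finset.sum_le_sum fun q _ =>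
            mul_le_mul_of_nonneg_left (hc s q)
              (mul_nonneg (π.visit_nonneg t s) (π.trans_nonneg s q))
        _ = _ := by rw [← Finset.sum_mul, ← Finset.mul_sum, π.trans_sum, mul_one, mul_comm]
    · refine (Finset.sum_eq_zero fun q _ => ?_).le
      rw [hoff s hsD q]
      by_cases h0 : ρ.trans s q = 0 <;> simp [h0]
  have hsum : Summable fun t => ∫ ξ, ‖f t ξ‖ ∂π.pathLaw :=
    Summable.of_nonneg_of_le (fun t => integral_nonneg fun _ => norm_nonneg _) hnorm
      (summable_sum fun s hs' => (hs s (Finset.mem_filter.1 hs').2).mul_left c)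
  have hint : Integrable (llr π.pathLaw ρ.pathLaw) π.pathLaw := by
    refine ⟨(measurable_llr _ _).aestronglyMeasurable, ?_⟩
    rw [HasFiniteIntegral]
    calc ∫⁻ ξ, ‖llr π.pathLaw ρ.pathLaw ξ‖ₑ ∂π.pathLaw
        ≤ ∫⁻ ξ, ∑' t, ‖f t ξ‖ₑ ∂π.pathLaw := by
          refine lintegral_mono_ae ?_
          filter_upwards [hllr] with ξ ⟨T, _, h⟩
          rw [h]
          exact (enorm_sum_le _ _).trans (ENNReal.sum_le_tsum _)
      _ = ∑' t, ∫⁻ ξ, ‖f t ξ‖ₑ ∂π.pathLaw := lintegral_tsum fun t => (hfi t).1.enorm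
      _ = ∑' t, ENNReal.ofReal (∫ ξ, ‖f t ξ‖ ∂π.pathLaw) := by
          simp_rw [ofReal_integral_norm_eq_lintegral_enorm (hfi _)]
      _ < ⊤ := by
          rw [← ENNReal.ofReal_tsum_of_nonneg
            (fun t => integral_nonneg fun _ => norm_nonneg _) hsum]
          exact ENNReal.ofReal_lt_top
  refine ⟨InformationTheory.klDiv_ne_top hμν hint, ?_⟩
  rw [kl, InformationTheory.toReal_klDiv_of_measure_eq hμν (by simp)]
  have h := hasSum_integral_of_summable_integral_norm hfi hsum
  rw [integral_congr_ae (g := llr π.pathLaw ρ.pathLaw)] at h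
  · simpa only [f, integral_log_ratio] using h
  · filter_upwards [hllr] with ξ ⟨T, h0, h1⟩
    rw [h1]
    exact tsum_eq_sum fun t ht => h0 t (not_lt.1 fun h => ht (Finset.mem_range.2 h))

end StationaryPolicy

/-! ### Divergence of flows and coercivity -/

/-- The divergence of a finite measure `y` from the multiple of `k` with the same total mass. -/
noncomputable def rowDiv {S : Type*} [Fintype S] (k y : S → ℝ) : ℝ :=
  ∑ q, y q * Real.log (y q / (k q * ∑ p, y p))

section RowDiv

variable {S : Type*} [Fintype S] {k y : S → ℝ}

lemma mul_log_div_eq_klFun {u v : ℝ} (h : v = 0 → u = 0) :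
    u * Real.log (u / v) = v * InformationTheory.klFun (u / v) + (u - v) := by
  by_cases hv : v = 0
  · simp [hv, h hv]
  · rw [InformationTheory.klFun_apply]
    field_simp
    ring

/-- The divergence as a sum of nonnegative terms; the linear parts of `klFun` cancel, since `y` and
`(∑ p, y p) • k` have the same mass. -/
lemma rowDiv_eq_sum_klFun (hk : ∑ q, k q = 1) (hy : ∀ q, 0 ≤ y q)
    (hac : ∀ q, k q = 0 → y q = 0) :
    rowDiv k y = ∑ q, k q * (∑ p, y p) *
      InformationTheory.klFun (y q / (k q * ∑ p, y p)) := by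
  have h : ∀ q, k q * (∑ p, y p) = 0 → y q = 0 := by
    intro q h0
    rcases mul_eq_zero.1 h0 with h0 | h0
    · exact hac q h0
    · exact (Finset.sum_eq_zero_iff_of_nonneg fun p _ => hy p).1 h0 q (Finset.mem_univ q)
  rw [rowDiv, Finset.sum_congr rfl fun q _ => mul_log_div_eq_klFun (h q), Finset.sum_add_distrib,
    Finset.sum_sub_distrib, ← Finset.sum_mul, hk]
  ring

lemma rowDiv_nonneg (hk0 : ∀ q, 0 ≤ k q) (hk : ∑ q, k q = 1) (hy : ∀ q, 0 ≤ y q)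
    (hac : ∀ q, k q = 0 → y q = 0) : 0 ≤ rowDiv k y := by
  rw [rowDiv_eq_sum_klFun hk hy hac]
  have hY : 0 ≤ ∑ p, y p := Finset.sum_nonneg fun p _ => hy p
  exact Finset.sum_nonneg fun q _ => mul_nonneg (mul_nonneg (hk0 q) hY)
    (InformationTheory.klFun_nonneg (div_nonneg (hy q) (mul_nonneg (hk0 q) hY)))

lemma eq_mul_of_rowDiv_eq_zero (hk0 : ∀ q, 0 ≤ k q) (hk : ∑ q, k q = 1) (hy : ∀ q, 0 ≤ y q)
    (hac : ∀ q, k q = 0 → y q = 0) (h : rowDiv k y = 0) (q : S) : y q = k q * ∑ p, y p := by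
  rw [rowDiv_eq_sum_klFun hk hy hac] at h
  have hY : 0 ≤ ∑ p, y p := Finset.sum_nonneg fun p _ => hy p
  have h1 := (Finset.sum_eq_zero_iff_of_nonneg fun q _ => mul_nonneg (mul_nonneg (hk0 q) hY)
    (InformationTheory.klFun_nonneg (div_nonneg (hy q) (mul_nonneg (hk0 q) hY)))).1 h q
    (Finset.mem_univ q)
  rcases mul_eq_zero.1 h1 with h2 | h2
  · rw [h2]
    rcases mul_eq_zero.1 h2 with h3 | h3
    · exact hac q h3
    · exact (Finset.sum_eq_zero_iff_of_nonneg fun p _ => hy p).1 h3 q (Finset.mem_univ q)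
  · have h3 := (InformationTheory.klFun_eq_zero_iff
      (div_nonneg (hy q) (mul_nonneg (hk0 q) hY))).1 h2
    exact eq_of_div_eq_one h3

lemma rowDiv_smul (c : ℝ) : rowDiv k (fun q => c * y q) = c * rowDiv k y := by
  by_cases hc : c = 0
  · simp [rowDiv, hc]
  · rw [rowDiv, rowDiv, Finset.mul_sum, ← Finset.mul_sum]
    refine Finset.sum_congr rfl fun q _ => ?_
    rw [mul_left_comm (k q) c, mul_div_mul_left _ _ hc, mul_assoc]

/-- A form of `rowDiv k y` that is continuous in `y`. -/
lemma rowDiv_eq_sub (hy : ∀ q, 0 ≤ y q) (hac : ∀ q, k q = 0 → y q = 0) :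
    rowDiv k y = ∑ q, (y q * Real.log (y q) - y q * Real.log (k q)) -
      (∑ q, y q) * Real.log (∑ q, y q) := by
  rw [rowDiv, Finset.sum_mul, ← Finset.sum_sub_distrib]
  refine Finset.sum_congr rfl fun q _ => ?_
  by_cases h0 : y q = 0
  · simp [h0]
  · have hk : k q ≠ 0 := fun h => h0 (hac q h)
    have hY : ∑ p, y p ≠ 0 := fun h =>
      h0 ((Finset.sum_eq_zero_iff_of_nonneg fun p _ => hy p).1 h q (Finset.mem_univ q))
    rw [Real.log_div h0 (mul_ne_zero hk hY), Real.log_mul hk hY]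
    ring

lemma continuous_rowDiv_sub : Continuous fun y : S → ℝ =>
    ∑ q, (y q * Real.log (y q) - y q * Real.log (k q)) -
      (∑ q, y q) * Real.log (∑ q, y q) := by
  have h : Continuous fun x : ℝ => x * Real.log x := Real.continuous_mul_log
  refine Continuous.sub ?_ (h.comp (by fun_prop))
  refine continuous_finsetSum _ fun q _ =>
    Continuous.sub (h.comp (continuous_apply q)) (by fun_prop)

end RowDiv

open Classical in
/-- On flows out of a set `D` without closed subsets, the divergence together with the net flow is
coercive: both are homogeneous, and they cannot vanish together on a flow of total mass 1, as such
a flow would be a circulation of the chain `k` inside `D`. -/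
theorem exists_pos_mul_sum_le {S : Type*} [Fintype S] {k : S → S → ℝ} (hk0 : ∀ s q, 0 ≤ k s q)
    (hk : ∀ s, ∑ q, k s q = 1) {D : Set S}
    (hD : ∀ B ⊆ D, (∀ s ∈ B, ∀ q, 0 < k s q → q ∈ B) → B = ∅) :
    ∃ δ > 0, ∀ y : S → S → ℝ, (∀ s ∈ D, ∀ q, 0 ≤ y s q) →
      (∀ s ∈ D, ∀ q, k s q = 0 → y s q = 0) →
      δ * ∑ s with s ∈ D, ∑ q, y s q ≤ ∑ s with s ∈ D, rowDiv (k s) (y s) +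
        ∑ s with s ∈ D, |∑ q, y s q - ∑ q with q ∈ D, y q s| := by
  let b : S → S → ℝ := fun s q => if s ∈ D ∧ k s q ≠ 0 then 1 else 0
  let N : (S → S → ℝ) → ℝ := fun y => ∑ s with s ∈ D, |∑ q, y s q - ∑ q with q ∈ D, y q s|
  let G : (S → S → ℝ) → ℝ := fun y => ∑ s with s ∈ D,
    (∑ q, (y s q * Real.log (y s q) - y s q * Real.log (k s q)) -
      (∑ q, y s q) * Real.log (∑ q, y s q)) + N y
  have hGc : Continuous G := by
    refine Continuous.add (continuous_finsetSum _ fun s _ => ?_) (by fun_prop)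
    exact (continuous_rowDiv_sub (k := k s)).comp (continuous_apply s)
  let K : Set (S → S → ℝ) := Set.Icc 0 b ∩ {y | ∑ s with s ∈ D, ∑ q, y s q = 1}
  have hK : IsCompact K :=
    isCompact_Icc.inter_right (isClosed_eq (by fun_prop) continuous_const)
  have hK0 : ∀ y ∈ K, ∀ s q, 0 ≤ y s q := fun y hy s q => hy.1.1 s q
  have hKac : ∀ y ∈ K, ∀ s q, k s q = 0 → y s q = 0 := by
    intro y hy s q h0
    refine le_antisymm ((hy.1.2 s q).trans ?_) (hK0 y hy s q)
    simp [b, h0]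
  have hGK : ∀ y ∈ K, G y = ∑ s with s ∈ D, rowDiv (k s) (y s) + N y := by
    intro y hy
    simp only [G]
    congr 1
    exact Finset.sum_congr rfl fun s _ => (rowDiv_eq_sub (hK0 y hy s) (hKac y hy s)).symm
  have hpos : ∀ y ∈ K, 0 < G y := by
    intro y hy
    have hrow : ∀ s, 0 ≤ rowDiv (k s) (y s) := fun s =>
      rowDiv_nonneg (hk0 s) (hk s) (hK0 y hy s) (hKac y hy s)
    have hR : 0 ≤ ∑ s with s ∈ D, rowDiv (k s) (y s) := Finset.sum_nonneg fun s _ => hrow s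
    have hN : 0 ≤ N y := Finset.sum_nonneg fun s _ => abs_nonneg _
    rw [hGK y hy]
    refine lt_of_le_of_ne (add_nonneg hR hN) fun h0 => ?_
    have hR0 : ∑ s with s ∈ D, rowDiv (k s) (y s) = 0 := by linarith
    have hN0 : N y = 0 := by linarith
    have hflow : ∀ s ∈ D, ∀ q, y s q = k s q * ∑ p, y s p := fun s hs q =>
      eq_mul_of_rowDiv_eq_zero (hk0 s) (hk s) (hK0 y hy s) (hKac y hy s)
        ((Finset.sum_eq_zero_iff_of_nonneg fun s _ => hrow s).1 hR0 s (by simpa using hs)) q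
    have hnet : ∀ s ∈ D, ∑ q, y s q = ∑ q with q ∈ D, y q s := fun s hs =>
      sub_eq_zero.1 (abs_eq_zero.1
        ((Finset.sum_eq_zero_iff_of_nonneg fun s _ => abs_nonneg _).1 hN0 s (by simpa using hs)))
    -- no mass leaves `D`
    have hout : ∀ s ∈ D, ∀ q ∉ D, y s q = 0 := by
      have h1 : ∑ s with s ∈ D, ∑ q, y s q = ∑ s with s ∈ D, ∑ q with q ∈ D, y s q := by
        rw [Finset.sum_comm (s := Finset.univ.filter (· ∈ D)) (t := Finset.univ.filter (· ∈ D))]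
        exact Finset.sum_congr rfl fun s hs => hnet s (Finset.mem_filter.1 hs).2
      have h2 : ∑ s with s ∈ D, ∑ q with q ∉ D, y s q = 0 := by
        have h3 : ∑ s with s ∈ D, ∑ q, y s q = ∑ s with s ∈ D, ∑ q with q ∈ D, y s q +
            ∑ s with s ∈ D, ∑ q with q ∉ D, y s q := by
          rw [← Finset.sum_add_distrib]
          exact Finset.sum_congr rfl fun s _ =>
            (Finset.sum_filter_add_sum_filter_not _ (· ∈ D) _).symm
        linarith
      intro s hs q hq
      have h4 := (Finset.sum_eq_zero_iff_of_nonneg fun s _ =>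
        Finset.sum_nonneg fun q _ => hK0 y hy s q).1 h2 s (by simpa using hs)
      exact (Finset.sum_eq_zero_iff_of_nonneg fun q _ => hK0 y hy s q).1 h4 q (by simpa using hq)
    have hB := hD {s | s ∈ D ∧ 0 < ∑ q, y s q} (fun s hs => hs.1) (by
      rintro s ⟨hs, hsp⟩ q hq
      have hyq : 0 < y s q := by rw [hflow s hs q]; exact mul_pos hq hsp
      have hqD : q ∈ D := by
        by_contra hn
        exact hyq.ne' (hout s hs q hn)
      refine ⟨hqD, ?_⟩
      rw [hnet q hqD]
      exact hyq.trans_le (Finset.single_le_sum (f := fun p => y p q)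
        (fun p _ => hK0 y hy p q) (by simpa using hs)))
    have h1 : ∑ s with s ∈ D, ∑ q, y s q = 1 := hy.2
    rw [Finset.sum_eq_zero] at h1
    · exact zero_ne_one h1
    · intro s hs
      by_contra hne
      have : s ∈ ({s | s ∈ D ∧ 0 < ∑ q, y s q} : Set S) :=
        ⟨(Finset.mem_filter.1 hs).2, lt_of_le_of_ne
          (Finset.sum_nonneg fun q _ => hK0 y hy s q) (Ne.symm hne)⟩
      rw [hB] at this
      exact this
  obtain ⟨δ, hδ, hδK⟩ := hK.exists_forall_le' hGc.continuousOn hpos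
  refine ⟨δ, hδ, fun y hy0 hyac => ?_⟩
  have hY : 0 ≤ ∑ s with s ∈ D, ∑ q, y s q := Finset.sum_nonneg fun s hs =>
    Finset.sum_nonneg fun q _ => hy0 s (Finset.mem_filter.1 hs).2 q
  have hrow : 0 ≤ ∑ s with s ∈ D, rowDiv (k s) (y s) := Finset.sum_nonneg fun s hs =>
    rowDiv_nonneg (hk0 s) (hk s) (hy0 s (Finset.mem_filter.1 hs).2)
      (hyac s (Finset.mem_filter.1 hs).2)
  set Y := ∑ s with s ∈ D, ∑ q, y s q with hYdef
  rcases hY.eq_or_lt with h0 | h0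
  · rw [← h0, mul_zero]
    exact add_nonneg hrow (Finset.sum_nonneg fun s _ => abs_nonneg _)
  -- normalise the flow to total mass 1, dropping the irrelevant rows
  let z : S → S → ℝ := fun s q => if s ∈ D then Y⁻¹ * y s q else 0
  have hzD : ∀ s ∈ D, z s = fun q => Y⁻¹ * y s q := fun s hs => by simp [z, hs]
  have hle : ∀ s ∈ D, ∀ q, y s q ≤ Y := fun s hs q =>
    (Finset.single_le_sum (f := fun q => y s q) (fun q _ => hy0 s hs q)
      (Finset.mem_univ q)).trans
    (Finset.single_le_sum (f := fun s => ∑ q, y s q) (fun s hs => Finset.sum_nonneg fun q _ =>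
      hy0 s (Finset.mem_filter.1 hs).2 q) (by simpa using hs))
  have hzK : z ∈ K := by
    refine ⟨⟨fun s q => ?_, fun s q => ?_⟩, ?_⟩
    · by_cases hs : s ∈ D
      · rw [hzD s hs]; exact mul_nonneg (inv_nonneg.2 h0.le) (hy0 s hs q)
      · simp [z, hs]
    · by_cases hs : s ∈ D
      · rw [hzD s hs]
        by_cases hkq : k s q = 0
        · simp [b, hkq, hyac s hs q hkq]
        · simpa [b, hs, hkq] using (inv_mul_le_one₀ h0).2 (hle s hs q)
      · simp [z, hs, b]
    · change ∑ s with s ∈ D, ∑ q, z s q = 1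
      rw [Finset.sum_congr rfl fun s hs => by rw [hzD s (Finset.mem_filter.1 hs).2]]
      simp_rw [← Finset.mul_sum]
      exact inv_mul_cancel₀ h0.ne'
  have hz := hδK z hzK
  rw [hGK z hzK] at hz
  have e1 : ∑ s with s ∈ D, rowDiv (k s) (z s) = Y⁻¹ * ∑ s with s ∈ D, rowDiv (k s) (y s) := by
    rw [Finset.mul_sum]
    refine Finset.sum_congr rfl fun s hs => ?_
    rw [hzD s (Finset.mem_filter.1 hs).2, rowDiv_smul]
  have e2 : N z = Y⁻¹ * N y := by
    simp only [N]
    rw [Finset.mul_sum]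
    refine Finset.sum_congr rfl fun s hs => ?_
    have h1 : ∑ q with q ∈ D, z q s = ∑ q with q ∈ D, Y⁻¹ * y q s :=
      Finset.sum_congr rfl fun q hq => by rw [hzD q (Finset.mem_filter.1 hq).2]
    rw [h1, hzD s (Finset.mem_filter.1 hs).2, ← Finset.mul_sum, ← Finset.mul_sum, ← mul_sub, abs_mul,
      abs_of_nonneg (inv_nonneg.2 h0.le)]
  rw [e1, e2, ← mul_add, le_inv_mul_iff₀ h0, mul_comm] at hz
  exact hz

/-! ### Closed sets and deviation states -/

namespace StationaryPolicy

variable {S A : Type*} [Fintype S] {M : MDP S A} (π : StationaryPolicy M)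

/-- A nonempty set that the chain cannot leave contains a closed communicating class: that of a
state with the fewest accessible states. -/
lemma eq_empty_of_disjoint_closedClasses {B : Set S} (hB : Disjoint B π.closedClasses)
    (hcl : π.IsClosedSet B) : B = ∅ := by
  classical
  by_contra hne
  obtain ⟨s, hs, hmin⟩ := Set.exists_min_image B (fun s => {q | π.Accessible s q}.ncard)
    B.toFinite (Set.nonempty_iff_ne_empty.2 hne)
  have hacc : ∀ q, π.Accessible s q → q ∈ B := fun q hq => by
    induction hq with
    | refl => exact hs
    | tail _ h ih => exact hcl _ ih _ h
  have hback : ∀ q, π.Accessible s q → π.Accessible q s := by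
    intro q hq
    have hsub : {p | π.Accessible q p} ⊆ {p | π.Accessible s p} := fun p hp => hq.trans hp
    have heq := Set.eq_of_subset_of_ncard_le hsub (hmin q (hacc q hq)) (Set.toFinite _)
    have : s ∈ {p | π.Accessible s p} := Relation.ReflTransGen.refl
    rwa [← heq] at this
  refine Set.disjoint_left.1 hB hs (Set.mem_sUnion.2
    ⟨{q | π.Accessible s q ∧ π.Accessible q s}, ⟨⟨s, rfl⟩, ?_⟩, .refl, .refl⟩)
  intro p hp q hq
  exact ⟨hp.1.tail hq, hback q (hp.1.tail hq)⟩

lemma eq_empty_of_subset_devStates {R B : Set S} (hB : B ⊆ π.devStates R)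
    (hcl : ∀ s ∈ B, ∀ q, 0 < π.trans s q → q ∈ B) : B = ∅ :=
  π.eq_empty_of_disjoint_closedClasses
    (Set.disjoint_left.2 fun _ hs hc => hB hs (Or.inl hc)) hcl

lemma trans_eq_zero_of_isAbsorbing {s q : S} (h : M.IsAbsorbing s) (hq : q ≠ s) :
    π.trans s q = 0 := by
  refine Finset.sum_eq_zero fun a ha => ?_
  have : ¬ 0 < M.P s a q := fun hp => hq (by
    have : q ∈ M.succ s := ⟨a, ha, hp⟩
    rwa [h] at this)
  rw [le_antisymm (not_lt.1 this) (M.P_nonneg s a ha q), zero_mul]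

lemma trans_self_of_isAbsorbing {s : S} (h : M.IsAbsorbing s) : π.trans s s = 1 := by
  rw [← π.trans_sum s, Fintype.sum_eq_single s fun q hq => π.trans_eq_zero_of_isAbsorbing h hq]

lemma trans_eq_zero_of_notMem_devStates {R : Set S} (hR : ∀ s ∈ R, M.IsAbsorbing s) {s q : S}
    (hs : s ∉ π.devStates R) (hq : q ∈ π.devStates R) : π.trans s q = 0 := by
  by_contra hne
  have hpos : 0 < π.trans s q := lt_of_le_of_ne (π.trans_nonneg s q) (Ne.symm hne)
  simp only [devStates, Set.mem_compl_iff, not_not] at hs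
  rcases hs with ⟨C, hC, hsC⟩ | hs
  · exact hq (Or.inl ⟨C, hC, hC.2 s hsC q hpos⟩)
  · have : q = s := by
      by_contra hqs
      exact hne (π.trans_eq_zero_of_isAbsorbing (hR s hs) hqs)
    exact hq (Or.inr (this ▸ hs))

/-- A closed communicating class with an absorbing state is a singleton. -/
lemma trans_eq_zero_of_notMem_of_mem {R : Set S} (hR : ∀ s ∈ R, M.IsAbsorbing s) {s q : S}
    (hs : s ∉ π.devStates R) (hsR : s ∉ R) (hq : q ∈ R) : π.trans s q = 0 := by
  by_contra hne
  have hpos : 0 < π.trans s q := lt_of_le_of_ne (π.trans_nonneg s q) (Ne.symm hne)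
  simp only [devStates, Set.mem_compl_iff, not_not] at hs
  rcases hs with ⟨C, hC, hsC⟩ | hs
  · obtain ⟨⟨c, rfl⟩, hcl⟩ := hC
    have hqC := hcl s hsC q hpos
    have hqs : π.Accessible q s := hqC.2.trans hsC.1
    have : ∀ p, π.Accessible q p → p = q := fun p hp => by
      induction hp with
      | refl => rfl
      | tail _ h ih =>
        subst ih
        by_contra hn
        exact h.ne' (π.trans_eq_zero_of_isAbsorbing (hR _ hq) hn)
    exact hsR (this s hqs ▸ hq)
  · exact hsR hs

end StationaryPolicy

/-! ### Real form of the occupancy divergence -/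

section RowDiv

variable {S : Type*} [Fintype S] {k p : S → ℝ}

lemma rowDiv_mul_of_sum_eq_one (hp : ∑ q, p q = 1) (v : ℝ) :
    rowDiv k (fun q => v * p q) = v * ∑ q, p q * Real.log (p q / k q) := by
  rw [rowDiv_smul, rowDiv, hp]
  simp only [mul_one]

end RowDiv

namespace Occupancy

variable {S A : Type*} [Fintype S] {M : MDP S A} {x : S → A → ℝ} {D : Set S}

lemma sum_flow (M : MDP S A) (x : S → A → ℝ) (s : S) : ∑ q, flow M x s q = total M x s := by
  unfold flow total
  rw [Finset.sum_comm]
  refine Finset.sum_congr rfl fun a ha => ?_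
  rw [← Finset.mul_sum, M.P_sum s a ha, mul_one]

lemma flow_nonneg {s : S} (hx : ∀ a ∈ M.act s, 0 ≤ x s a) (q : S) : 0 ≤ flow M x s q :=
  Finset.sum_nonneg fun a ha => mul_nonneg (hx a ha) (M.P_nonneg s a ha q)

lemma total_nonneg {s : S} (hx : ∀ a ∈ M.act s, 0 ≤ x s a) : 0 ≤ total M x s :=
  Finset.sum_nonneg fun a ha => hx a ha

lemma flow_eq_zero_of_notMem_succ {s q : S} (hq : q ∉ M.succ s) : flow M x s q = 0 := by
  refine Finset.sum_eq_zero fun a ha => ?_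
  have : ¬ 0 < M.P s a q := fun hp => hq ⟨a, ha, hp⟩
  rw [le_antisymm (not_lt.1 this) (M.P_nonneg s a ha q), mul_zero]

/-- The flow `x` out of `D` follows transitions that are possible under `πS`. -/
def FlowAC (x : S → A → ℝ) (πS : StationaryPolicy M) (D : Set S) : Prop :=
  ∀ s ∈ D, ∀ q, πS.trans s q = 0 → flow M x s q = 0

lemma coe_ereal_sum {ι : Type*} (s : Finset ι) (f : ι → ℝ) :
    ((∑ i ∈ s, f i : ℝ) : EReal) = ∑ i ∈ s, (f i : EReal) :=
  map_sum (⟨⟨Real.toEReal, EReal.coe_zero⟩, EReal.coe_add⟩ : ℝ →+ EReal) f s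

open Classical in
lemma kl_eq_coe {πS : StationaryPolicy M} (hx : ∀ s ∈ D, ∀ a ∈ M.act s, 0 ≤ x s a)
    (hac : FlowAC x πS D) :
    kl x πS D = ((∑ s with s ∈ D, rowDiv (πS.trans s) (flow M x s) : ℝ) : EReal) := by
  have hterm : ∀ s ∈ D, ∀ q, klTerm (flow M x s q) (πS.trans s q * total M x s) =
      ((flow M x s q * Real.log (flow M x s q / (πS.trans s q * total M x s)) : ℝ) : EReal) := by
    intro s hs q
    unfold klTerm
    split_ifs with h1 h2
    · simp [h1]
    · rcases mul_eq_zero.1 h2 with h3 | h3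
      · exact absurd (hac s hs q h3) h1
      · rw [← sum_flow, Finset.sum_eq_zero_iff_of_nonneg fun q _ => flow_nonneg (hx s hs) q] at h3
        exact absurd (h3 q (Finset.mem_univ q)) h1
    · rfl
  unfold kl
  rw [coe_ereal_sum]
  refine Finset.sum_congr rfl fun s hs => ?_
  have hs' : s ∈ D := (Finset.mem_filter.1 hs).2
  rw [rowDiv, coe_ereal_sum, sum_flow, Finset.sum_filter]
  refine Finset.sum_congr rfl fun q _ => ?_
  split_ifs with hq
  · exact hterm s hs' q
  · simp [flow_eq_zero_of_notMem_succ hq]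

lemma klTerm_ne_bot (u v : ℝ) : klTerm u v ≠ ⊥ := by
  unfold klTerm
  split_ifs
  · exact EReal.zero_ne_bot
  · exact top_ne_bot
  · exact EReal.coe_ne_bot _

lemma ereal_sum_ne_bot {ι : Type*} (s : Finset ι) {f : ι → EReal} (h : ∀ i ∈ s, f i ≠ ⊥) :
    ∑ i ∈ s, f i ≠ ⊥ := by
  classical
  induction s using Finset.induction_on with
  | empty => simp
  | insert i s hi ih =>
    rw [Finset.sum_insert hi]
    exact EReal.add_ne_bot_iff.2 ⟨h i (Finset.mem_insert_self i s),
      ih fun j hj => h j (Finset.mem_insert_of_mem hj)⟩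

lemma ereal_sum_eq_top {ι : Type*} (s : Finset ι) {f : ι → EReal} (h : ∀ i ∈ s, f i ≠ ⊥) {i : ι}
    (hi : i ∈ s) (hf : f i = ⊤) : ∑ j ∈ s, f j = ⊤ := by
  classical
  rw [← Finset.add_sum_erase s f hi, hf]
  exact EReal.top_add_of_ne_bot (ereal_sum_ne_bot _ fun j hj => h j (Finset.mem_of_mem_erase hj))

lemma flowAC_of_kl_ne_top {πS : StationaryPolicy M} (h : kl x πS D ≠ ⊤) : FlowAC x πS D := by
  classical
  intro s hs q hq
  by_contra hne
  refine h (ereal_sum_eq_top _ (fun s _ => ereal_sum_ne_bot _ fun q _ => klTerm_ne_bot _ _)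
    (Finset.mem_filter.2 ⟨Finset.mem_univ s, hs⟩) ?_)
  have hqs : q ∈ M.succ s := by
    by_contra hn
    exact hne (flow_eq_zero_of_notMem_succ hn)
  refine ereal_sum_eq_top _ (fun q _ => klTerm_ne_bot _ _)
    (Finset.mem_filter.2 ⟨Finset.mem_univ q, hqs⟩) ?_
  simp [klTerm, hne, hq]

end Occupancy

/-! ### Occupancy measures of a policy of finite divergence -/

namespace StationaryPolicy

variable {S A : Type*} [Fintype S] {M : MDP S A} {π πS : StationaryPolicy M} {R : Set S}
variable [MeasurableSpace S] [MeasurableSingletonClass S]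

lemma TransAC.visit_mul_trans_eq_zero (hac : π.TransAC πS) {s q : S} (h : πS.trans s q = 0)
    (t : ℕ) : π.visit t s * π.trans s q = 0 := by
  by_contra hne
  have h1 := (π.visit_nonneg t s).lt_of_ne (Ne.symm (left_ne_zero_of_mul hne))
  have h2 := (π.trans_nonneg s q).lt_of_ne (Ne.symm (right_ne_zero_of_mul hne))
  exact (hac t s q h1 h2).ne' h

open Classical in
/-- The deviation states are entered from deviation states only. -/
lemma TransAC.visit_succ_devStates (hac : π.TransAC πS) (hR : ∀ s ∈ R, M.IsAbsorbing s) {q : S}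
    (hq : q ∈ πS.devStates R) (t : ℕ) :
    π.visit (t + 1) q = ∑ s with s ∈ πS.devStates R, π.visit t s * π.trans s q := by
  rw [visit_succ, Finset.sum_filter]
  refine Finset.sum_congr rfl fun s _ => ?_
  split_ifs with hs
  · rfl
  · exact hac.visit_mul_trans_eq_zero (πS.trans_eq_zero_of_notMem_devStates hR hs hq) t

open Classical in
/-- The target set is entered from deviation states only. -/
lemma TransAC.visit_succ_target (hac : π.TransAC πS) (hR : ∀ s ∈ R, M.IsAbsorbing s) {q : S}
    (hq : q ∈ R) (t : ℕ) :
    π.visit (t + 1) q =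
      π.visit t q + ∑ s with s ∈ πS.devStates R, π.visit t s * π.trans s q := by
  have hqD : q ∉ πS.devStates R := fun h => h (Or.inr hq)
  rw [visit_succ, Finset.sum_filter, ← Finset.add_sum_erase _ _ (Finset.mem_univ q),
    π.trans_self_of_isAbsorbing (hR q hq), mul_one,
    ← Finset.add_sum_erase _ (fun s => if s ∈ πS.devStates R then
      π.visit t s * π.trans s q else 0) (Finset.mem_univ q), if_neg hqD, zero_add]
  congr 1
  refine Finset.sum_congr rfl fun s hs => ?_
  split_ifs with hsD
  · rfl
  · by_cases hsR : s ∈ R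
    · rw [π.trans_eq_zero_of_isAbsorbing (hR s hsR) (Finset.ne_of_mem_erase hs).symm, mul_zero]
    · exact hac.visit_mul_trans_eq_zero (πS.trans_eq_zero_of_notMem_of_mem hR hsD hsR hq) t

lemma TransAC.visit_mul_stepKL (hac : π.TransAC πS) (t : ℕ) (s : S) :
    0 ≤ π.visit t s * π.stepKL πS s := by
  rw [stepKL, ← rowDiv_mul_of_sum_eq_one (π.trans_sum s)]
  exact rowDiv_nonneg (πS.trans_nonneg s) (πS.trans_sum s)
    (fun q => mul_nonneg (π.visit_nonneg t s) (π.trans_nonneg s q))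
    fun q hq => hac.visit_mul_trans_eq_zero hq t

/-- A policy of finite divergence spends a finite expected time in the deviation states: the
truncated occupancy measures have bounded divergence and net flow, so they are bounded by
coercivity. -/
lemma summable_visit (hkl : π.kl πS ≠ ⊤) (hR : ∀ s ∈ R, M.IsAbsorbing s) {s : S}
    (hs : s ∈ πS.devStates R) : Summable fun t => π.visit t s := by
  classical
  have hac := TransAC.of_absolutelyContinuous (InformationTheory.klDiv_ne_top_iff.1 hkl).1
  set D := πS.devStates R with hDdef
  obtain ⟨δ, hδ, hle⟩ := exists_pos_mul_sum_le πS.trans_nonneg πS.trans_sum (D := D)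
    fun B hB hcl => πS.eq_empty_of_subset_devStates hB hcl
  refine summable_of_sum_range_le (c := ((π.kl πS).toReal +
    ∑ s with s ∈ D, (1 : ℝ)) / δ) (fun t => π.visit_nonneg t s) fun T => ?_
  let v : S → ℝ := fun s => ∑ t ∈ Finset.range T, π.visit t s
  have hv : ∀ s, 0 ≤ v s := fun s => Finset.sum_nonneg fun t _ => π.visit_nonneg t s
  have h := hle (fun s q => v s * π.trans s q)
    (fun s _ q => mul_nonneg (hv s) (π.trans_nonneg s q)) (fun s _ q hq => by
      simp only [v, Finset.sum_mul]
      exact Finset.sum_eq_zero fun t _ => hac.visit_mul_trans_eq_zero hq t)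
  simp only [← Finset.mul_sum, π.trans_sum, mul_one] at h
  have h1 : ∑ s with s ∈ D, rowDiv (πS.trans s) (fun q => v s * π.trans s q) ≤
      (π.kl πS).toReal := by
    refine le_trans ?_ (sum_stepKL_le_kl hkl T)
    rw [Finset.sum_comm, Finset.sum_filter]
    refine Finset.sum_le_sum fun s _ => ?_
    rw [rowDiv_mul_of_sum_eq_one (π.trans_sum s)]
    change (if s ∈ D then v s * π.stepKL πS s else 0) ≤ _
    rw [← Finset.sum_mul]
    split_ifs
    · exact le_rfl
    · rw [Finset.sum_mul]
      exact Finset.sum_nonneg fun t _ => hac.visit_mul_stepKL t s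
  have h2 : ∑ s with s ∈ D, |v s - ∑ q with q ∈ D, v q * π.trans q s| ≤
      ∑ s with s ∈ D, (1 : ℝ) := by
    refine Finset.sum_le_sum fun s hs => ?_
    have h3 : ∑ q with q ∈ D, v q * π.trans q s =
        ∑ t ∈ Finset.range T, π.visit (t + 1) s := by
      simp only [v, Finset.sum_mul]
      rw [Finset.sum_comm]
      exact Finset.sum_congr rfl fun t _ =>
        (hac.visit_succ_devStates hR (Finset.mem_filter.1 hs).2 t).symm
    rw [h3, ← Finset.sum_sub_distrib, Finset.sum_range_sub', abs_sub_le_iff]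
    constructor <;> linarith [π.visit_nonneg 0 s, π.visit_nonneg T s, π.visit_le_one 0 s,
      π.visit_le_one T s]
  rw [le_div_iff₀ hδ, mul_comm]
  refine le_trans (mul_le_mul_of_nonneg_left ?_ hδ.le) (h.trans (add_le_add h1 h2))
  exact Finset.single_le_sum (f := v) (fun s _ => hv s) (by simpa using hs)

/-- The expected time spent in a state (meaningful where it is finite). -/
noncomputable def stateOcc (π : StationaryPolicy M) (s : S) : ℝ := ∑' t, π.visit t s

lemma occ_eq {s : S} (hs : Summable fun t => π.visit t s) (a : A) :
    π.occ s a = ENNReal.ofReal (π.stateOcc s * π.prob s a) := by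
  rw [occ, ENNReal.tsum_mul_right, stateOcc,
    ENNReal.ofReal_mul (tsum_nonneg fun t => π.visit_nonneg t s),
    ENNReal.ofReal_tsum_of_nonneg (fun t => π.visit_nonneg t s) hs]
  congr 2
  funext t
  exact (ofReal_measureReal).symm

lemma stateOcc_nonneg (s : S) : 0 ≤ π.stateOcc s := tsum_nonneg fun t => π.visit_nonneg t s

lemma occVec_eq {s : S} (hs : Summable fun t => π.visit t s) (a : A) :
    π.occVec s a = π.stateOcc s * π.prob s a := by
  rw [occVec, occ_eq hs, ENNReal.toReal_ofReal (mul_nonneg (stateOcc_nonneg s) (π.prob_nonneg s a))]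

lemma flow_occVec {s : S} (hs : Summable fun t => π.visit t s) (q : S) :
    Occupancy.flow M π.occVec s q = π.stateOcc s * π.trans s q := by
  rw [Occupancy.flow, trans, Finset.mul_sum]
  refine Finset.sum_congr rfl fun a _ => ?_
  rw [occVec_eq hs]
  ring

lemma total_occVec {s : S} (hs : Summable fun t => π.visit t s) :
    Occupancy.total M π.occVec s = π.stateOcc s := by
  rw [← Occupancy.sum_flow]
  simp only [flow_occVec hs]
  rw [← Finset.mul_sum, π.trans_sum, mul_one]

open Classical in
lemma TransAC.stateOcc_eq (hac : π.TransAC πS) (hR : ∀ s ∈ R, M.IsAbsorbing s)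
    (hs : ∀ s ∈ πS.devStates R, Summable fun t => π.visit t s) {s : S}
    (hsD : s ∈ πS.devStates R) :
    π.stateOcc s = (if s = M.s₀ then 1 else 0) +
      ∑ q with q ∈ πS.devStates R, π.stateOcc q * π.trans q s := by
  have h : ∀ q ∈ Finset.univ.filter (· ∈ πS.devStates R),
      HasSum (fun t => π.visit t q * π.trans q s) (π.stateOcc q * π.trans q s) :=
    fun q hq => (hs q (Finset.mem_filter.1 hq).2).hasSum.mul_right _
  rw [stateOcc, (hs s hsD).tsum_eq_zero_add, visit_zero, ← (hasSum_sum h).tsum_eq]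
  simp only [hac.visit_succ_devStates hR hsD]

lemma TransAC.netFlow_occVec (hac : π.TransAC πS) (hR : ∀ s ∈ R, M.IsAbsorbing s)
    (hs : ∀ s ∈ πS.devStates R, Summable fun t => π.visit t s) {s : S}
    (hsD : s ∈ πS.devStates R) :
    Occupancy.netFlow M π.occVec (πS.devStates R) s = 0 := by
  classical
  unfold Occupancy.netFlow
  rw [total_occVec (hs s hsD), hac.stateOcc_eq hR hs hsD, Finset.sum_congr rfl fun q hq =>
    flow_occVec (hs q (Finset.mem_filter.1 hq).2) s]
  ring

open Classical in
lemma reach_occVec (hs : ∀ s ∈ πS.devStates R, Summable fun t => π.visit t s) :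
    Occupancy.reach M π.occVec (πS.devStates R) R =
      ∑ q with q ∈ R, ((∑ s with s ∈ πS.devStates R, π.stateOcc s * π.trans s q) +
        (if q = M.s₀ then 1 else 0)) := by
  unfold Occupancy.reach
  refine Finset.sum_congr rfl fun q _ => ?_
  congr 1
  exact Finset.sum_congr rfl fun s hs' => flow_occVec (hs s (Finset.mem_filter.1 hs').2) q

lemma TransAC.reach_occVec_eq (hac : π.TransAC πS) (hR : ∀ s ∈ R, M.IsAbsorbing s)
    (hs : ∀ s ∈ πS.devStates R, Summable fun t => π.visit t s) :
    Occupancy.reach M π.occVec (πS.devStates R) R = π.pathLaw.real {ξ | ∃ t, ξ t ∈ R} := by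
  classical
  have h1 : ∀ q ∈ R, Filter.Tendsto (fun T => π.visit T q) Filter.atTop
      (nhds ((∑ s with s ∈ πS.devStates R, π.stateOcc s * π.trans s q) +
        (if q = M.s₀ then 1 else 0))) := by
    intro q hq
    have h2 : ∀ T, π.visit T q = (∑ s with s ∈ πS.devStates R,
        (∑ t ∈ Finset.range T, π.visit t s) * π.trans s q) + (if q = M.s₀ then 1 else 0) := by
      intro T
      induction T with
      | zero => simp [visit_zero]
      | succ T ih =>
        rw [hac.visit_succ_target hR hq, ih]
        simp only [Finset.sum_range_succ, add_mul, Finset.sum_add_distrib]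
        ring
    simp only [h2]
    refine Filter.Tendsto.add (tendsto_finsetSum _ fun s hs' => ?_) tendsto_const_nhds
    exact ((hs s (Finset.mem_filter.1 hs').2).hasSum.tendsto_sum_nat).mul_const _
  have h3 : Filter.Tendsto (fun T => ∑ q with q ∈ R, π.visit T q) Filter.atTop
      (nhds (Occupancy.reach M π.occVec (πS.devStates R) R)) := by
    rw [reach_occVec hs]
    exact tendsto_finsetSum _ fun q hq => h1 q (Finset.mem_filter.1 hq).2
  have h4 : Filter.Tendsto (fun T => π.pathLaw.real
      (Set.accumulate (fun t => {ξ : ℕ → S | ξ t ∈ R}) T)) Filter.atTop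
      (nhds (π.pathLaw.real {ξ | ∃ t, ξ t ∈ R})) := by
    have := tendsto_measure_iUnion_accumulate (μ := π.pathLaw)
      (f := fun t : ℕ => {ξ : ℕ → S | ξ t ∈ R})
    rw [show (⋃ t : ℕ, {ξ : ℕ → S | ξ t ∈ R}) = {ξ | ∃ t, ξ t ∈ R} by ext; simp] at this
    exact (ENNReal.tendsto_toReal (measure_ne_top _ _)).comp this
  refine tendsto_nhds_unique h3 (h4.congr fun T => ?_)
  -- the target set is absorbing, so it has been reached by time `T` iff it is occupied at `T`
  have hD : ∀ s ∉ Rᶜ, ∀ q ∈ Rᶜ, π.trans s q = 0 := fun s hs q hq =>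
    π.trans_eq_zero_of_isAbsorbing (hR s (not_not.1 hs)) fun h => hq (h ▸ not_not.1 hs)
  calc π.pathLaw.real (Set.accumulate (fun t => {ξ : ℕ → S | ξ t ∈ R}) T) =
        π.pathLaw.real {ξ | ξ T ∈ R} := by
        refine measureReal_congr ?_
        filter_upwards [ae_notMem_of_le hD] with ξ h
        refine propext ⟨fun h5 => ?_, fun h5 => Set.mem_accumulate.2 ⟨T, le_rfl, h5⟩⟩
        obtain ⟨t, ht, h6⟩ := Set.mem_accumulate.1 h5
        exact not_not.1 (h t (not_not.2 h6) T ht)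
    _ = ∫ ξ, (fun s => if s ∈ R then (1 : ℝ) else 0) (ξ T) ∂π.pathLaw := by
        rw [← integral_indicator_one (measurableSet_path (fun s => s ∈ R) T)]
        refine integral_congr_ae (ae_of_all _ fun ξ => ?_)
        simp [Set.indicator_apply]
    _ = _ := by
        rw [π.integral_visit T fun s => if s ∈ R then (1 : ℝ) else 0, Finset.sum_filter]
        simp

/-- The occupancy measures of a policy of finite divergence have at most its divergence. -/
lemma kl_occVec_le (hkl : π.kl πS ≠ ⊤) (hR : ∀ s ∈ R, M.IsAbsorbing s) :
    Occupancy.kl π.occVec πS (πS.devStates R) ≤ ((π.kl πS : ℝ≥0∞) : EReal) := by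
  classical
  have hac := TransAC.of_absolutelyContinuous (InformationTheory.klDiv_ne_top_iff.1 hkl).1
  have hs : ∀ s ∈ πS.devStates R, Summable fun t => π.visit t s := fun s hs =>
    summable_visit hkl hR hs
  rw [Occupancy.kl_eq_coe, ← EReal.coe_ennreal_toReal hkl, EReal.coe_le_coe_iff]
  · have h1 : Filter.Tendsto (fun T => ∑ s with s ∈ πS.devStates R,
        (∑ t ∈ Finset.range T, π.visit t s) * π.stepKL πS s) Filter.atTop
        (nhds (∑ s with s ∈ πS.devStates R, π.stateOcc s * π.stepKL πS s)) :=
      tendsto_finsetSum _ fun s hs' =>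
        ((hs s (Finset.mem_filter.1 hs').2).hasSum.tendsto_sum_nat).mul_const _
    have h2 : ∑ s with s ∈ πS.devStates R, rowDiv (πS.trans s) (Occupancy.flow M π.occVec s) =
        ∑ s with s ∈ πS.devStates R, π.stateOcc s * π.stepKL πS s := by
      refine Finset.sum_congr rfl fun s hs' => ?_
      rw [stepKL, ← rowDiv_mul_of_sum_eq_one (π.trans_sum s)]
      congr 1
      funext q
      exact flow_occVec (hs s (Finset.mem_filter.1 hs').2) q
    rw [h2]
    refine le_of_tendsto' h1 fun T => le_trans ?_ (sum_stepKL_le_kl hkl T)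
    rw [Finset.sum_comm]
    simp only [Finset.sum_mul]
    exact Finset.sum_le_sum_of_subset_of_nonneg (Finset.filter_subset _ _) fun s _ _ =>
      Finset.sum_nonneg fun t _ => hac.visit_mul_stepKL t s
  · exact fun s _ a _ => ENNReal.toReal_nonneg
  · intro s hs' q hq
    rw [flow_occVec (hs s hs'), stateOcc, ← tsum_mul_right]
    simp only [hac.visit_mul_trans_eq_zero hq, tsum_zero]

end StationaryPolicy

/-! ### Continuity and boundedness of the occupancy objective -/

namespace Occupancy

variable {S A : Type*} [Fintype S] {M : MDP S A} {x y : S → A → ℝ} {D : Set S}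

lemma flow_congr {s : S} (h : ∀ a ∈ M.act s, x s a = y s a) : flow M x s = flow M y s := by
  funext q
  exact Finset.sum_congr rfl fun a ha => by rw [h a ha]

lemma netFlow_congr (h : ∀ s ∈ D, ∀ a ∈ M.act s, x s a = y s a) {s : S} (hs : s ∈ D) :
    netFlow M x D s = netFlow M y D s := by
  classical
  have h1 : ∑ q with q ∈ D, flow M x q s = ∑ q with q ∈ D, flow M y q s :=
    Finset.sum_congr rfl fun q hq => by rw [flow_congr (h q (Finset.mem_filter.1 hq).2)]
  unfold netFlow
  rw [← sum_flow, ← sum_flow, flow_congr (h s hs), h1]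

lemma reach_congr {R : Set S} (h : ∀ s ∈ D, ∀ a ∈ M.act s, x s a = y s a) :
    reach M x D R = reach M y D R := by
  classical
  unfold reach
  refine Finset.sum_congr rfl fun q _ => ?_
  rw [Finset.sum_congr rfl fun s hs => by rw [flow_congr (h s (Finset.mem_filter.1 hs).2)]]

lemma continuous_flow (M : MDP S A) : Continuous fun x : S → A → ℝ => flow M x := by
  unfold flow
  fun_prop

lemma continuous_netFlow (M : MDP S A) (D : Set S) (s : S) :
    Continuous fun x : S → A → ℝ => netFlow M x D s := by
  unfold netFlow total flow
  fun_prop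

lemma continuous_reach (M : MDP S A) (D R : Set S) :
    Continuous fun x : S → A → ℝ => reach M x D R := by
  unfold reach flow
  fun_prop

open Classical in
/-- The divergence of an occupancy vector in the form in which it is continuous. -/
noncomputable def klSub (πS : StationaryPolicy M) (D : Set S) (x : S → A → ℝ) : ℝ :=
  ∑ s with s ∈ D, (∑ q, (flow M x s q * Real.log (flow M x s q) -
    flow M x s q * Real.log (πS.trans s q)) -
      (∑ q, flow M x s q) * Real.log (∑ q, flow M x s q))

lemma continuous_klSub (πS : StationaryPolicy M) (D : Set S) : Continuous (klSub πS D) := by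
  classical
  refine continuous_finsetSum _ fun s _ => ?_
  exact (continuous_rowDiv_sub (k := πS.trans s)).comp
    ((continuous_apply s).comp (continuous_flow M))

open Classical in
lemma sum_rowDiv_eq_klSub {πS : StationaryPolicy M}
    (hx : ∀ s ∈ D, ∀ a ∈ M.act s, 0 ≤ x s a) (hac : FlowAC x πS D) :
    ∑ s with s ∈ D, rowDiv (πS.trans s) (flow M x s) = klSub πS D x :=
  Finset.sum_congr rfl fun s hs => rowDiv_eq_sub (flow_nonneg (hx s (Finset.mem_filter.1 hs).2))
    (hac s (Finset.mem_filter.1 hs).2)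

lemma kl_eq_klSub {πS : StationaryPolicy M} (hx : ∀ s ∈ D, ∀ a ∈ M.act s, 0 ≤ x s a)
    (hac : FlowAC x πS D) : kl x πS D = (klSub πS D x : EReal) := by
  rw [kl_eq_coe hx hac, sum_rowDiv_eq_klSub hx hac]

lemma klSub_congr {πS : StationaryPolicy M} (h : ∀ s ∈ D, ∀ a ∈ M.act s, x s a = y s a) :
    klSub πS D x = klSub πS D y := by
  classical
  exact Finset.sum_congr rfl fun s hs => by rw [flow_congr (h s (Finset.mem_filter.1 hs).2)]

/-- Occupancy vectors that satisfy the flow equation are bounded in terms of their divergence. -/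
lemma exists_le_of_klSub_le (πS : StationaryPolicy M) (R : Set S) (c : ℝ) :
    ∃ b : ℝ, ∀ x : S → A → ℝ, (∀ s ∈ πS.devStates R, ∀ a ∈ M.act s, 0 ≤ x s a) →
      FlowAC x πS (πS.devStates R) →
      (∀ s ∈ πS.devStates R, netFlow M x (πS.devStates R) s = 0) →
      klSub πS (πS.devStates R) x ≤ c → ∀ s ∈ πS.devStates R, ∀ a ∈ M.act s, x s a ≤ b := by
  classical
  obtain ⟨δ, hδ, hle⟩ := exists_pos_mul_sum_le πS.trans_nonneg πS.trans_sum
    (D := πS.devStates R) fun B hB hcl => πS.eq_empty_of_subset_devStates hB hcl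
  refine ⟨(c + ∑ s with s ∈ πS.devStates R, (1 : ℝ)) / δ, fun x hx hac hnet hc s hs a ha => ?_⟩
  have h := hle (flow M x) (fun s hs => flow_nonneg (hx s hs)) hac
  simp only [sum_flow] at h
  have h1 : x s a ≤ ∑ s with s ∈ πS.devStates R, total M x s :=
    (Finset.single_le_sum (f := fun a => x s a) (hx s hs) ha).trans
      (Finset.single_le_sum (f := fun s => total M x s)
        (fun s hs => total_nonneg (hx s (Finset.mem_filter.1 hs).2)) (by simpa using hs))
  rw [le_div_iff₀ hδ, mul_comm]
  refine (mul_le_mul_of_nonneg_left h1 hδ.le).trans (h.trans (add_le_add ?_ ?_))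
  · rwa [sum_rowDiv_eq_klSub hx hac]
  · refine Finset.sum_le_sum fun s hs => ?_
    have h2 := hnet s (Finset.mem_filter.1 hs).2
    unfold netFlow at h2
    rw [sub_eq_zero.1 h2]
    split_ifs <;> simp

end Occupancy

/-! ### The policy of an occupancy vector -/

namespace StationaryPolicy

variable {S A : Type*} [Fintype S] {M : MDP S A}

open Classical in
/-- The policy that chooses the actions at the states of `D` in proportion to `x`, and follows
`πS` outside `D` and where `x` vanishes. -/
noncomputable def ofOccupancy (πS : StationaryPolicy M) (D : Set S) (x : S → A → ℝ)
    (hx : ∀ s ∈ D, ∀ a ∈ M.act s, 0 ≤ x s a) : StationaryPolicy M where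
  prob s a := if s ∈ D ∧ Occupancy.total M x s ≠ 0 then
      (if a ∈ M.act s then x s a / Occupancy.total M x s else 0) else πS.prob s a
  prob_nonneg s a := by
    split_ifs with h1 h2
    · exact div_nonneg (hx s h1.1 a h2) (Occupancy.total_nonneg (hx s h1.1))
    · exact le_rfl
    · exact πS.prob_nonneg s a
  prob_le_one s a := by
    split_ifs with h1 h2
    · exact div_le_one_of_le₀ (Finset.single_le_sum (f := fun a => x s a) (hx s h1.1) h2)
        (Occupancy.total_nonneg (hx s h1.1))
    · exact zero_le_one
    · exact πS.prob_le_one s a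
  prob_sum s := by
    split_ifs with h1
    · rw [← Finset.sum_div]
      exact div_self h1.2
    · exact πS.prob_sum s

variable {πS : StationaryPolicy M} {D : Set S} {x : S → A → ℝ}
  (hx : ∀ s ∈ D, ∀ a ∈ M.act s, 0 ≤ x s a)

lemma trans_ofOccupancy_of_not {s : S} (hs : ¬ (s ∈ D ∧ Occupancy.total M x s ≠ 0)) (q : S) :
    (ofOccupancy πS D x hx).trans s q = πS.trans s q := by
  simp only [trans, ofOccupancy, if_neg hs]

lemma total_mul_trans_ofOccupancy {s : S} (hs : s ∈ D) (q : S) :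
    Occupancy.total M x s * (ofOccupancy πS D x hx).trans s q = Occupancy.flow M x s q := by
  by_cases h : Occupancy.total M x s = 0
  · have h1 := Occupancy.sum_flow M x s
    rw [h, Finset.sum_eq_zero_iff_of_nonneg fun q _ => Occupancy.flow_nonneg (hx s hs) q] at h1
    rw [h, zero_mul, h1 q (Finset.mem_univ q)]
  · have h' : s ∈ D ∧ Occupancy.total M x s ≠ 0 := ⟨hs, h⟩
    simp only [trans, ofOccupancy, if_pos h']
    rw [Finset.mul_sum, Occupancy.flow]
    refine Finset.sum_congr rfl fun a ha => ?_
    rw [if_pos ha]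
    field_simp

lemma trans_pos_of_ofOccupancy (hac : Occupancy.FlowAC x πS D) {s q : S}
    (h : 0 < (ofOccupancy πS D x hx).trans s q) : 0 < πS.trans s q := by
  by_cases hs : s ∈ D ∧ Occupancy.total M x s ≠ 0
  · refine (πS.trans_nonneg s q).lt_of_ne fun h0 => ?_
    have h1 := total_mul_trans_ofOccupancy (πS := πS) hx hs.1 q
    rw [hac s hs.1 q h0.symm] at h1
    exact (mul_ne_zero hs.2 h.ne') h1
  · rwa [trans_ofOccupancy_of_not hx hs] at h

variable [MeasurableSpace S] [MeasurableSingletonClass S]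

/-- An occupancy vector of finite divergence that satisfies the flow equation is matched by a
policy. The occupancy measures of the policy are at most `x`, as the least solution of the flow
equation, and they differ from `x` by a circulation, which does not reach `R`. -/
theorem exists_policy_of_occupancy {R : Set S} (hR : ∀ s ∈ R, M.IsAbsorbing s)
    (hx : ∀ s ∈ πS.devStates R, ∀ a ∈ M.act s, 0 ≤ x s a)
    (hnet : ∀ s ∈ πS.devStates R, Occupancy.netFlow M x (πS.devStates R) s = 0)
    (hkl : Occupancy.kl x πS (πS.devStates R) ≠ ⊤) :
    ∃ π : StationaryPolicy M, π.kl πS ≠ ⊤ ∧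
      ((π.kl πS : ℝ≥0∞) : EReal) ≤ Occupancy.kl x πS (πS.devStates R) ∧
      Occupancy.reach M π.occVec (πS.devStates R) R =
        Occupancy.reach M x (πS.devStates R) R := by
  classical
  set D := πS.devStates R with hD
  have hfac := Occupancy.flowAC_of_kl_ne_top hkl
  let π := ofOccupancy πS D x hx
  have hac : π.TransAC πS := fun _ _ _ _ h => trans_pos_of_ofOccupancy hx hfac h
  have hoff : ∀ s ∉ D, ∀ q, π.trans s q = πS.trans s q := fun s hs =>
    trans_ofOccupancy_of_not hx fun h => hs h.1
  have hclosed : ∀ s ∉ D, ∀ q ∈ D, πS.trans s q = 0 := fun s hs q hq =>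
    πS.trans_eq_zero_of_notMem_devStates hR hs hq
  have hmul : ∀ s ∈ D, ∀ q, Occupancy.total M x s * π.trans s q = Occupancy.flow M x s q :=
    fun s hs q => total_mul_trans_ofOccupancy hx hs q
  have hbal : ∀ s ∈ D, Occupancy.total M x s = (if s = M.s₀ then 1 else 0) +
      ∑ q with q ∈ D, Occupancy.total M x q * π.trans q s := by
    intro s hs
    have h := hnet s hs
    unfold Occupancy.netFlow at h
    rw [Finset.sum_congr rfl fun q hq => hmul q (Finset.mem_filter.1 hq).2 s]
    linarith
  have hbound : ∀ T, ∀ s ∈ D, ∑ t ∈ Finset.range T, π.visit t s ≤ Occupancy.total M x s := by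
    intro T
    induction T with
    | zero => intro s hs; simpa using Occupancy.total_nonneg (hx s hs)
    | succ T ih =>
      intro s hs
      rw [Finset.sum_range_succ', visit_zero, add_comm, hbal s hs]
      refine add_le_add le_rfl ?_
      rw [Finset.sum_congr rfl fun t _ => hac.visit_succ_devStates hR hs t, Finset.sum_comm]
      refine Finset.sum_le_sum fun q hq => ?_
      rw [← Finset.sum_mul]
      exact mul_le_mul_of_nonneg_right (ih q (Finset.mem_filter.1 hq).2) (π.trans_nonneg q s)
  have hs : ∀ s ∈ D, Summable fun t => π.visit t s := fun s hs =>
    summable_of_sum_range_le (fun t => π.visit_nonneg t s) fun T => hbound T s hs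
  obtain ⟨hfin, hsum⟩ := kl_of_summable hac hoff hclosed hs
  refine ⟨π, hfin, ?_, ?_⟩
  · rw [Occupancy.kl_eq_coe hx hfac, ← EReal.coe_ennreal_toReal hfin, EReal.coe_le_coe_iff]
    refine le_of_tendsto' hsum.tendsto_sum_nat fun T => ?_
    rw [Finset.sum_comm, Finset.sum_filter]
    refine Finset.sum_le_sum fun s _ => ?_
    rw [← Finset.sum_mul]
    split_ifs with hsD
    · have h1 : Occupancy.flow M x s = fun q => Occupancy.total M x s * π.trans s q :=
        funext fun q => (hmul s hsD q).symm
      rw [h1, rowDiv_mul_of_sum_eq_one (π.trans_sum s)]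
      refine mul_le_mul_of_nonneg_right (hbound T s hsD) ?_
      have h2 := rowDiv_nonneg (πS.trans_nonneg s) (πS.trans_sum s) (π.trans_nonneg s) fun q hq =>
        le_antisymm (not_lt.1 fun h => (trans_pos_of_ofOccupancy hx hfac h).ne' hq)
          (π.trans_nonneg s q)
      have h3 := rowDiv_mul_of_sum_eq_one (k := πS.trans s) (π.trans_sum s) 1
      simp only [one_mul] at h3
      rwa [h3] at h2
    · have h0 : π.stepKL πS s = 0 := by
        refine Finset.sum_eq_zero fun q _ => ?_
        rw [hoff s hsD q]
        by_cases h0 : πS.trans s q = 0 <;> simp [h0]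
      rw [h0, mul_zero]
  · -- the excess `c` of `x` over the occupancy measures is a circulation inside `D`
    let c : S → ℝ := fun s => Occupancy.total M x s - π.stateOcc s
    have hc0 : ∀ s ∈ D, 0 ≤ c s := fun s hsD =>
      sub_nonneg.2 ((hs s hsD).tsum_le_of_sum_range_le fun T => hbound T s hsD)
    have hc : ∀ s ∈ D, c s = ∑ q with q ∈ D, c q * π.trans q s := by
      intro s hsD
      simp only [c, sub_mul, Finset.sum_sub_distrib]
      rw [hbal s hsD, hac.stateOcc_eq hR hs hsD]
      ring
    have hout : ∀ s ∈ D, ∀ q ∉ D, c s * π.trans s q = 0 := by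
      have h1 : ∑ s with s ∈ D, c s = ∑ s with s ∈ D, ∑ q with q ∈ D, c s * π.trans s q := by
        rw [Finset.sum_comm]
        exact Finset.sum_congr rfl fun s hs => hc s (Finset.mem_filter.1 hs).2
      have h2 : ∑ s with s ∈ D, c s = ∑ s with s ∈ D, ∑ q with q ∈ D, c s * π.trans s q +
          ∑ s with s ∈ D, ∑ q with q ∉ D, c s * π.trans s q := by
        rw [← Finset.sum_add_distrib]
        refine Finset.sum_congr rfl fun s _ => ?_
        rw [Finset.sum_filter_add_sum_filter_not, ← Finset.mul_sum, π.trans_sum, mul_one]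
      have h0 : ∀ s ∈ D, ∀ q, 0 ≤ c s * π.trans s q := fun s hsD q =>
        mul_nonneg (hc0 s hsD) (π.trans_nonneg s q)
      have h3 : ∑ s with s ∈ D, ∑ q with q ∉ D, c s * π.trans s q = 0 := by linarith
      intro s hsD q hq
      have h4 := (Finset.sum_eq_zero_iff_of_nonneg fun s hs => Finset.sum_nonneg fun q _ =>
        h0 s (Finset.mem_filter.1 hs).2 q).1 h3 s (by simpa using hsD)
      exact (Finset.sum_eq_zero_iff_of_nonneg fun q _ => h0 s hsD q).1 h4 q (by simpa using hq)
    rw [reach_occVec hs]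
    unfold Occupancy.reach
    refine Finset.sum_congr rfl fun q hq => ?_
    congr 1
    refine Finset.sum_congr rfl fun s hs' => ?_
    have hsD : s ∈ D := (Finset.mem_filter.1 hs').2
    have h5 := hout s hsD q fun h => h (Or.inr (Finset.mem_filter.1 hq).2)
    rw [← hmul s hsD q]
    simp only [c, sub_mul] at h5
    linarith

end StationaryPolicy

/-! ### The team problems -/

section Team

variable {n : ℕ} {S A : Fin n → Type*} [∀ i, Fintype (S i)] {M : ∀ i, MDP (S i) (A i)}
  {πS : ∀ i, StationaryPolicy (M i)} {R : ∀ i, Set (S i)} {ν : ℝ}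

lemma OccFeasible.congr {x y : ∀ i, S i → A i → ℝ} (h : OccFeasible πS R ν x)
    (hxy : ∀ i, ∀ s ∈ (πS i).devStates (R i), ∀ a ∈ (M i).act s, x i s a = y i s a) :
    OccFeasible πS R ν y where
  flow_eq i s hs := by rw [← Occupancy.netFlow_congr (hxy i) hs]; exact h.flow_eq i s hs
  reach_le := by
    rw [Finset.prod_congr rfl fun i _ => by rw [← Occupancy.reach_congr (hxy i)]]
    exact h.reach_le
  nonneg i s hs a ha := by rw [← hxy i s hs a ha]; exact h.nonneg i s hs a ha

lemma kl_ne_top_of_occObjective {x : ∀ i, S i → A i → ℝ} (h : occObjective πS R x ≠ ⊤)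
    (i : Fin n) : Occupancy.kl (x i) (πS i) ((πS i).devStates (R i)) ≠ ⊤ :=
  ((le_iSup (fun i => Occupancy.kl (x i) (πS i) ((πS i).devStates (R i))) i).trans_lt
    h.lt_top).ne

/-- The occupancy problem attains a finite optimal value: by coercivity its sublevel sets are
bounded, and on flows along possible transitions the objective is continuous. -/
theorem exists_occObjective_eq_occValue (hn : 0 < n) (h : occValue πS R ν < ⊤) :
    ∃ x, OccFeasible πS R ν x ∧ occObjective πS R x = occValue πS R ν := by
  classical
  have : Nonempty (Fin n) := ⟨⟨0, hn⟩⟩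
  obtain ⟨x₀, h₀⟩ := iInf_lt_iff.1 h
  obtain ⟨hf₀, h₀⟩ := iInf_lt_iff.1 h₀
  let D : ∀ i, Set (S i) := fun i => (πS i).devStates (R i)
  let F : (∀ i, S i → A i → ℝ) → ℝ := fun x =>
    Finset.univ.sup' Finset.univ_nonempty fun i => Occupancy.klSub (πS i) (D i) (x i)
  have hFc : Continuous F := Continuous.finset_sup'_apply _ fun i _ =>
    (Occupancy.continuous_klSub (πS i) (D i)).comp (continuous_apply i)
  have hac : ∀ x, occObjective πS R x ≠ ⊤ → ∀ i, Occupancy.FlowAC (x i) (πS i) (D i) :=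
    fun x hx i => Occupancy.flowAC_of_kl_ne_top (kl_ne_top_of_occObjective hx i)
  choose b hb using fun i => Occupancy.exists_le_of_klSub_le (πS i) (R i) (F x₀)
  let β : ∀ i, S i → A i → ℝ := fun i s a => if s ∈ D i ∧ a ∈ (M i).act s then b i else 0
  let K : Set (∀ i, S i → A i → ℝ) := Set.Icc 0 β ∩
    ({x | ∀ i, ∀ s ∈ D i, Occupancy.netFlow (M i) (x i) (D i) s = 0} ∩
      ({x | ∏ i, (1 - Occupancy.reach (M i) (x i) (D i) (R i)) ≤ 1 - ν} ∩
        {x | ∀ i, Occupancy.FlowAC (x i) (πS i) (D i)}))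
  have hK : IsCompact K := by
    refine isCompact_Icc.inter_right (IsClosed.inter ?_ (IsClosed.inter ?_ ?_))
    · simp only [Set.ofPred_forall]
      exact isClosed_iInter fun i => isClosed_iInter fun s => isClosed_iInter fun _ =>
        isClosed_eq ((Occupancy.continuous_netFlow (M i) (D i) s).comp (continuous_apply i))
          continuous_const
    · refine isClosed_le (continuous_finsetProd _ fun i _ => continuous_const.sub ?_)
        continuous_const
      exact (Occupancy.continuous_reach (M i) (D i) (R i)).comp (continuous_apply i)
    · simp only [Occupancy.FlowAC, Set.ofPred_forall]
      refine isClosed_iInter fun i => isClosed_iInter fun s => isClosed_iInter fun _ =>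
        isClosed_iInter fun q => isClosed_iInter fun _ => isClosed_eq ?_ continuous_const
      exact (continuous_apply q).comp ((continuous_apply s).comp
        ((Occupancy.continuous_flow (M i)).comp (continuous_apply i)))
  have hKf : ∀ x ∈ K, OccFeasible πS R ν x := fun x hx =>
    ⟨hx.2.1, hx.2.2.1, fun i s _ a _ => hx.1.1 i s a⟩
  -- vectors in the sublevel set of `x₀` lie in `K` once their irrelevant entries are set to 0
  have hKmem : ∀ x, OccFeasible πS R ν x → occObjective πS R x ≠ ⊤ → F x ≤ F x₀ →
      ∃ y ∈ K, F y = F x := by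
    intro x hx hox hFx
    let y : ∀ i, S i → A i → ℝ := fun i s a => if s ∈ D i ∧ a ∈ (M i).act s then x i s a else 0
    have hxy : ∀ i, ∀ s ∈ D i, ∀ a ∈ (M i).act s, x i s a = y i s a := fun i s hs a ha =>
      (if_pos ⟨hs, ha⟩).symm
    have hy := hx.congr hxy
    have hF : F y = F x := Finset.sup'_congr _ rfl fun i _ =>
      (Occupancy.klSub_congr (hxy i)).symm
    refine ⟨y, ⟨⟨fun i s a => ?_, fun i s a => ?_⟩, hy.flow_eq, hy.reach_le, fun i s hs q hq => ?_⟩,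
      hF⟩
    · change (0 : ℝ) ≤ if _ then _ else _
      split_ifs with h1
      · exact hx.nonneg i s h1.1 a h1.2
      · exact le_rfl
    · simp only [y, β]
      split_ifs with h1
      · exact hb i (x i) (hx.nonneg i) (hac x hox i) (hx.flow_eq i)
          ((Finset.le_sup' (fun i => Occupancy.klSub (πS i) (D i) (x i))
            (Finset.mem_univ i)).trans hFx) s h1.1 a h1.2
      · exact le_rfl
    · rw [← Occupancy.flow_congr (hxy i s hs)]
      exact hac x hox i s hs q hq
  obtain ⟨y₀, hy₀, hFy₀⟩ := hKmem x₀ hf₀ h₀.ne le_rfl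
  obtain ⟨z, hz, hmin⟩ := hK.exists_isMinOn ⟨y₀, hy₀⟩ hFc.continuousOn
  refine ⟨z, hKf z hz, le_antisymm (le_iInf₂ fun x hx => ?_) (iInf₂_le z (hKf z hz))⟩
  by_cases hox : occObjective πS R x = ⊤
  · rw [hox]; exact le_top
  have hzx : F z ≤ F x := by
    rcases le_total (F x) (F x₀) with h1 | h1
    · obtain ⟨y, hy, hFy⟩ := hKmem x hx hox h1
      exact hFy ▸ hmin hy
    · exact (hmin hy₀).trans (hFy₀.le.trans h1)
  obtain ⟨j, -, hj⟩ := Finset.exists_mem_eq_sup' Finset.univ_nonempty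
    fun i => Occupancy.klSub (πS i) (D i) (x i)
  refine iSup_le fun i => ?_
  rw [Occupancy.kl_eq_klSub ((hKf z hz).nonneg i) (hz.2.2.2 i)]
  refine le_trans ?_ (le_iSup (fun i => Occupancy.kl (x i) (πS i) ((πS i).devStates (R i))) j)
  rw [Occupancy.kl_eq_klSub (hx.nonneg j) (hac x hox j), EReal.coe_le_coe_iff]
  refine le_trans (Finset.le_sup' (fun i => Occupancy.klSub (πS i) (D i) (z i))
    (Finset.mem_univ i)) (hzx.trans hj.le)

variable [∀ i, MeasurableSpace (S i)] [∀ i, MeasurableSingletonClass (S i)]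

lemma disjReachProb_eq (π : ∀ i, StationaryPolicy (M i)) (R : ∀ i, Set (S i)) :
    disjReachProb π R = 1 - ∏ i, (1 - (π i).pathLaw.real {ξ | ∃ t, ξ t ∈ R i}) := by
  have hm : ∀ i, MeasurableSet {ξ : ℕ → S i | ∃ t, ξ t ∈ R i} := by
    intro i
    rw [Set.ofPred_exists]
    exact MeasurableSet.iUnion fun t => StationaryPolicy.measurableSet_path (fun s => s ∈ R i) t
  have hc : {ξ : ∀ i, ℕ → S i | ∃ i, ∃ t, ξ i t ∈ R i} =
      (Set.pi Set.univ fun i => {ξ : ℕ → S i | ∃ t, ξ t ∈ R i}ᶜ)ᶜ := by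
    ext ξ
    simp
  rw [disjReachProb, hc, probReal_compl_eq_one_sub
    (MeasurableSet.univ_pi fun i => (hm i).compl), measureReal_def, Measure.pi_pi,
    ENNReal.toReal_prod]
  congr 1
  exact Finset.prod_congr rfl fun i _ => probReal_compl_eq_one_sub (hm i)

lemma occFeasible_occVec_iff (hR : ∀ i, ∀ s ∈ R i, (M i).IsAbsorbing s)
    {π : ∀ i, StationaryPolicy (M i)} (h : ∀ i, (π i).kl (πS i) ≠ ⊤) :
    OccFeasible πS R ν (fun i => (π i).occVec) ↔ ν ≤ disjReachProb π R := by
  have hac := fun i => StationaryPolicy.TransAC.of_absolutelyContinuous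
    (InformationTheory.klDiv_ne_top_iff.1 (h i)).1
  have hs : ∀ i, ∀ s ∈ (πS i).devStates (R i), Summable fun t => (π i).visit t s :=
    fun i s hs => StationaryPolicy.summable_visit (h i) (hR i) hs
  have hreach : ∏ i, (1 - Occupancy.reach (M i) (π i).occVec ((πS i).devStates (R i)) (R i)) =
      ∏ i, (1 - (π i).pathLaw.real {ξ | ∃ t, ξ t ∈ R i}) :=
    Finset.prod_congr rfl fun i _ => by rw [(hac i).reach_occVec_eq (hR i) (hs i)]
  rw [disjReachProb_eq]
  constructor
  · intro hf
    have := hf.reach_le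
    rw [hreach] at this
    linarith
  · intro hν
    refine ⟨fun i s hsD => (hac i).netFlow_occVec (hR i) (hs i) hsD, ?_,
      fun i s _ a _ => ENNReal.toReal_nonneg⟩
    rw [hreach]
    linarith

lemma kl_ne_top_of_worstKL {π : ∀ i, StationaryPolicy (M i)} (h : worstKL π πS ≠ ⊤) (i : Fin n) :
    (π i).kl (πS i) ≠ ⊤ := by
  intro h0
  refine h (top_le_iff.1 ?_)
  calc (⊤ : EReal) = (((π i).kl (πS i) : ℝ≥0∞) : EReal) := by rw [h0]; rfl
    _ ≤ worstKL π πS := le_iSup (fun i => (((π i).kl (πS i) : ℝ≥0∞) : EReal)) i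

lemma occObjective_occVec_le (hR : ∀ i, ∀ s ∈ R i, (M i).IsAbsorbing s)
    {π : ∀ i, StationaryPolicy (M i)} (h : ∀ i, (π i).kl (πS i) ≠ ⊤) :
    occObjective πS R (fun i => (π i).occVec) ≤ worstKL π πS :=
  iSup_mono fun i => StationaryPolicy.kl_occVec_le (h i) (hR i)

lemma exists_policies_of_occFeasible (hR : ∀ i, ∀ s ∈ R i, (M i).IsAbsorbing s)
    {x : ∀ i, S i → A i → ℝ} (hx : OccFeasible πS R ν x) (h : occObjective πS R x ≠ ⊤) :
    ∃ π : ∀ i, StationaryPolicy (M i), (∀ i, (π i).kl (πS i) ≠ ⊤) ∧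
      worstKL π πS ≤ occObjective πS R x ∧ ν ≤ disjReachProb π R := by
  choose π h1 h2 h3 using fun i => StationaryPolicy.exists_policy_of_occupancy (hR i)
    (hx.nonneg i) (hx.flow_eq i) (kl_ne_top_of_occObjective h i)
  refine ⟨π, h1, iSup_mono h2, ?_⟩
  have hac := fun i => StationaryPolicy.TransAC.of_absolutelyContinuous
    (InformationTheory.klDiv_ne_top_iff.1 (h1 i)).1
  have hs : ∀ i, ∀ s ∈ (πS i).devStates (R i), Summable fun t => (π i).visit t s :=
    fun i s hs => StationaryPolicy.summable_visit (h1 i) (hR i) hs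
  have hreach := hx.reach_le
  rw [Finset.prod_congr rfl fun i _ => by
    rw [← h3 i, (hac i).reach_occVec_eq (hR i) (hs i)]] at hreach
  rw [disjReachProb_eq]
  linarith

theorem policyValue_eq_occValue (hR : ∀ i, ∀ s ∈ R i, (M i).IsAbsorbing s) :
    policyValue πS R ν = occValue πS R ν := by
  refine le_antisymm (le_iInf₂ fun x hx => ?_) (le_iInf₂ fun π hπ => ?_)
  · by_cases h : occObjective πS R x = ⊤
    · rw [h]; exact le_top
    · obtain ⟨π, -, h1, h2⟩ := exists_policies_of_occFeasible hR hx h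
      exact (iInf₂_le π h2).trans h1
  · by_cases h : worstKL π πS = ⊤
    · rw [h]; exact le_top
    · have h1 := kl_ne_top_of_worstKL h
      exact (iInf₂_le _ ((occFeasible_occVec_iff hR h1).2 hπ)).trans (occObjective_occVec_le hR h1)

end Team

theorem proposition1 {n : ℕ} (hn : 0 < n) {S A : Fin n → Type*} [∀ i, Fintype (S i)]
    [∀ i, MeasurableSpace (S i)] [∀ i, MeasurableSingletonClass (S i)]
    (M : ∀ i, MDP (S i) (A i)) (πS : ∀ i, StationaryPolicy (M i)) (R : ∀ i, Set (S i))
    (hR : ∀ i, ∀ s ∈ R i, (M i).IsAbsorbing s) (ν : ℝ) (hν : 0 ≤ ν) :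
    policyValue πS R ν = occValue πS R ν ∧
      (policyValue πS R ν < ⊤ →
        ∃ π : ∀ i, StationaryPolicy (M i),
          ν ≤ disjReachProb π R ∧
          worstKL π πS = policyValue πS R ν ∧
          (∀ i, ∀ s ∈ (πS i).devStates (R i), ∀ a ∈ (M i).act s, (π i).occ s a ≠ ⊤) ∧
          OccFeasible πS R ν (fun i => (π i).occVec) ∧
          occObjective πS R (fun i => (π i).occVec) = occValue πS R ν) := by
  refine ⟨policyValue_eq_occValue hR, fun hlt => ?_⟩
  rw [policyValue_eq_occValue hR] at hlt ⊢
  obtain ⟨x, hx, hxv⟩ := exists_occObjective_eq_occValue hn hlt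
  obtain ⟨π, hkl, hle, hreach⟩ := exists_policies_of_occFeasible hR hx (hxv ▸ hlt.ne)
  have hfeas := (occFeasible_occVec_iff hR hkl).2 hreach
  have hworst : worstKL π πS ≤ occValue πS R ν := hle.trans hxv.le
  refine ⟨π, hreach, le_antisymm hworst ?_, fun i s hs a _ => ?_, hfeas,
    le_antisymm ((occObjective_occVec_le hR hkl).trans hworst) (iInf₂_le _ hfeas)⟩
  · rw [← policyValue_eq_occValue hR]
    exact iInf₂_le π hreach
  · rw [StationaryPolicy.occ_eq (StationaryPolicy.summable_visit (hkl i) (hR i) hs)]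
    exact ENNReal.ofReal_ne_top
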